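/- Let $K > 1$ and $0 < t < 2$, and put $t' = \frac{2Kt}{2+(K-1)t}$. Then there exist a compact set $E \subset \mathbb{C}$ with $0 < \mathcal{H}^t(E) < \infty$ and a $K$-quasiconformal mapping $\phi : \mathbb{C} \to \mathbb{C}$ such that $0 < \mathcal{H}^{t'}(\phi(E)) < \infty$. Here $\mathcal{H}^s$ denotes $s$-dimensional Hausdorff measure, and a mapping $\phi : \mathbb{C} \to \mathbb{C}$ is called $K$-quasiconformal if it is an orientation preserving homeomorphism of $\mathbb{C}$ onto $\mathbb{C}$ that belongs to the Sobolev space $W^{1,2}_{\mathrm{loc}}(\mathbb{C})$ and satisfies $\max_\alpha |\partial_\alpha \phi| \le K \min_\alpha |\partial_\alpha \phi|$ almost everywhere in $\mathbb{C}$, where $\partial_\alpha$ is the derivative in the direction $e^{i\alpha}$. -/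

import Mathlib

open MeasureTheory
open scoped ContDiff

/-- `G` is a weak (distributional) derivative of `f` on the plane `ℂ = ℝ²`: for almost every `z`,
the real-linear map `G z` plays the role of `Df(z)`, so that `G z (exp (α i))` is the
directional derivative `∂_α f(z)`. Weakness is tested against real test functions `η ∈ C_c^∞`,
in every direction `v`. -/
def HasWeakDerivative (f : ℂ → ℂ) (G : ℂ → ℂ →L[ℝ] ℂ) : Prop :=
  ∀ η : ℂ → ℝ, ContDiff ℝ ∞ η → HasCompactSupport η → ∀ v : ℂ,
    ∫ z, (fderiv ℝ η z v) • f z = - ∫ z, η z • G z v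

/-- `f` belongs to the local Sobolev space `W^{1,2}_loc(ℂ)` and `G` is its weak derivative:
both `f` and `G` are square integrable on compact sets. -/
structure IsSobolevLocWith (f : ℂ → ℂ) (G : ℂ → ℂ →L[ℝ] ℂ) : Prop where
  memLp : ∀ C : Set ℂ, IsCompact C → MemLp f 2 (volume.restrict C)
  memLp_deriv : ∀ C : Set ℂ, IsCompact C → MemLp G 2 (volume.restrict C)
  hasWeakDerivative : HasWeakDerivative f G

/-- A homeomorphism `f` of the plane is orientation preserving if its local degree at every point
is `+1`: as `z` runs once counterclockwise around any circle centred at `c`, the increment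
`f z - f c` winds exactly once counterclockwise around `0`. The winding number is read off from a
continuous logarithm `a` of the loop. -/
def IsOrientationPreserving (f : ℂ → ℂ) : Prop :=
  ∀ (c : ℂ) (r : ℝ), 0 < r → ∃ a : ℝ → ℂ, Continuous a ∧
    (∀ θ : ℝ, Complex.exp (a θ) = f (circleMap c r θ) - f c) ∧
    a (2 * Real.pi) - a 0 = 2 * Real.pi * Complex.I

/-- `f : ℂ → ℂ` is a `K`-quasiconformal mapping of the plane: an orientation preserving
homeomorphism of `ℂ` onto `ℂ`, in `W^{1,2}_loc(ℂ)`, whose directional derivatives satisfy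
`max_α |∂_α f| ≤ K min_β |∂_β f|` almost everywhere. -/
structure IsQuasiconformal (K : ℝ) (f : ℂ → ℂ) : Prop where
  isHomeomorph : IsHomeomorph f
  orientationPreserving : IsOrientationPreserving f
  distortion : ∃ G : ℂ → ℂ →L[ℝ] ℂ, IsSobolevLocWith f G ∧
    ∀ᵐ z : ℂ, ∀ α β : ℝ,
      ‖G z (Complex.exp (α * Complex.I))‖ ≤ K * ‖G z (Complex.exp (β * Complex.I))‖

/-! Both sets are Cantor sets coded by the same words over one sequence of disc packings of the unit
disc. A disc of radius `r` with centre `c` carries a similarity of ratio `r ^ (1 + α)` onto a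
concentric smaller disc, where `α = 2 / t - 1`. Since `(1 + α) * t = 2`, the `t`-th power of a ratio
is `r ^ 2`, so sums of `t`-th powers over a generation are products of area proportions of packings.
Besicovitch's theorem makes each proportion so close to `1` that these products stay between `1 / 2`
and `1`.

The image set uses the parameter `α / K`, and `(1 + α / K) * t' = 2`, so the same two Hausdorff
estimates serve for both sets. The upper bound covers by the pieces of one generation. The lower
bound is a Frostman estimate for the product measure that weights discs by area: after rescaling at
the first generation where a set splits, the selected discs fit in a disc comparable to the
diameter, and disjointness of their interiors bounds their total area (`sum_sq_le_of_dist_le`,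
`infinitePi_weight_preimage_le`).

The map is built from the radial stretch `‖z‖ ^ (K⁻¹ - 1) • z` on each annulus between a packing
disc and its smaller disc. This takes inner radius `r ^ α` to `r ^ (α / K)` relative to the packing
disc and is the identity on the outer circle. Inside the smaller disc the map is a similarity, where
the next generation is inserted. Nontrivial distortion is thus applied at most once at almost every
point, and distortions do not multiply.

The approximations and their inverses, which have the same form, converge uniformly, so the limit is
a homeomorphism. Its energy is at most `K ^ 2` times image area, and it differs from an
approximation only on a set of small area. Together these facts let weak derivatives pass to the
limit (`exists_isHomeomorph_limit`, `isSobolevLocWith_of_limit`). -/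

namespace DiskCantor

open Metric Set Filter Topology
open scoped ENNReal NNReal

/-! ### Disc packings and area -/

/-- A finite family of non-overlapping discs in the closed unit disc. -/
structure DiskPacking where
  card : ℕ
  center : Fin card → ℂ
  radius : Fin card → ℝ
  radius_pos : ∀ i, 0 < radius i
  norm_center_add_radius_le : ∀ i, ‖center i‖ + radius i ≤ 1
  radius_add_radius_le : ∀ i j, i ≠ j → radius i + radius j ≤ dist (center i) (center j)

namespace DiskPacking

variable (P : DiskPacking)

/-- The area of a packing, as a proportion of the area of the unit disc. -/
noncomputable def mass : ℝ := ∑ i, P.radius i ^ 2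

lemma radius_le_one (i : Fin P.card) : P.radius i ≤ 1 := by
  have := P.norm_center_add_radius_le i
  linarith [norm_nonneg (P.center i)]

/-- Area comparison: the open discs are disjoint and lie in a disc of radius `ρ`. This is the only
geometric input to the Frostman estimate. -/
lemma sum_sq_le {J : Finset (Fin P.card)} {x : ℂ} {ρ : ℝ} (hρ : 0 ≤ ρ)
    (h : ∀ i ∈ J, dist (P.center i) x + P.radius i ≤ ρ) :
    ∑ i ∈ J, P.radius i ^ 2 ≤ ρ ^ 2 := by
  have hsub : (⋃ i ∈ J, ball (P.center i) (P.radius i)) ⊆ ball x ρ :=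
    iUnion₂_subset fun i hi => ball_subset_ball' (by linarith [h i hi])
  have hdisj : (J : Set (Fin P.card)).PairwiseDisjoint
      fun i => ball (P.center i) (P.radius i) := fun i _ j _ hij =>
    ball_disjoint_ball (P.radius_add_radius_le i j hij)
  have hvol := measure_mono (μ := volume) hsub
  rw [measure_biUnion_finset hdisj fun _ _ => measurableSet_ball] at hvol
  simp only [Complex.volume_ball] at hvol
  rw [← Finset.sum_mul] at hvol
  have hpi : (NNReal.pi : ℝ≥0∞) ≠ 0 := by
    simpa using NNReal.pi_pos.ne'
  rw [ENNReal.mul_le_mul_iff_left hpi ENNReal.coe_ne_top] at hvol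
  simp only [← ENNReal.ofReal_pow (P.radius_pos _).le, ← ENNReal.ofReal_pow hρ] at hvol
  rw [← ENNReal.ofReal_sum_of_nonneg fun _ _ => sq_nonneg _] at hvol
  exact (ENNReal.ofReal_le_ofReal_iff (sq_nonneg _)).1 hvol

lemma mass_le_one : P.mass ≤ 1 := by
  have := P.sum_sq_le (J := Finset.univ) (x := 0) zero_le_one
    (by simpa using P.norm_center_add_radius_le)
  simpa [mass] using this

/-- The unit disc can be packed by small discs up to an arbitrarily small proportion of its area. -/
theorem exists_mass_ge {η δ : ℝ} (hη : η < 1) (hδ : 0 < δ) :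
    ∃ P : DiskPacking, η ≤ P.mass ∧ ∀ i, P.radius i ≤ δ := by
  -- Radii below `1 - ‖x‖` keep the discs inside the unit disc, and radii below `δ` keep them small.
  -- The countable family has full area, so a finite part exceeds the proportion `η`.
  obtain ⟨s, r, hs, hsub, hr, hcov, hdisj⟩ := Besicovitch.exists_disjoint_closedBall_covering_ae
    (volume : Measure ℂ) (fun _ => univ) (ball 0 1)
    (fun x _ d hd => ⟨d / 2, mem_univ _, by simp [hd]⟩)
    (fun x => min δ (1 - ‖x‖)) (fun x hx => by
      simp only [mem_ball_zero_iff] at hx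
      exact lt_min hδ (by linarith))
  simp only [univ_inter, mem_Ioo, lt_min_iff] at hr
  have hpi : (NNReal.pi : ℝ≥0∞) ≠ 0 := by simpa using NNReal.pi_pos.ne'
  have h1 : 1 ≤ ∑' x : s, ENNReal.ofReal (r x ^ 2) := by
    have : volume (ball (0 : ℂ) 1) ≤ volume (⋃ x ∈ s, closedBall x (r x)) := by
      calc volume (ball (0 : ℂ) 1)
          ≤ volume (ball 0 1 \ ⋃ x ∈ s, closedBall x (r x))
            + volume (⋃ x ∈ s, closedBall x (r x)) := by
            refine (measure_mono ?_).trans (measure_union_le _ _)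
            intro x hx
            by_cases h : x ∈ ⋃ x ∈ s, closedBall x (r x)
            · exact Or.inr h
            · exact Or.inl ⟨hx, h⟩
        _ = _ := by rw [hcov, zero_add]
    rw [measure_biUnion hs hdisj fun _ _ => measurableSet_closedBall] at this
    simp only [Complex.volume_ball, Complex.volume_closedBall] at this
    rw [ENNReal.tsum_mul_right, ENNReal.mul_le_mul_iff_left hpi ENNReal.coe_ne_top] at this
    simpa [ENNReal.ofReal_pow (hr _ (Subtype.prop _)).1.le] using this
  have h2 : ENNReal.ofReal η < ∑' x : s, ENNReal.ofReal (r x ^ 2) :=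
    lt_of_lt_of_le (by simpa using hη) h1
  obtain ⟨J, hJ⟩ := ((tendsto_order.1
    (ENNReal.summable (f := fun x : s => ENNReal.ofReal (r x ^ 2))).hasSum).1 _ h2).exists
  let e := J.equivFin.symm
  have hrs : ∀ i, _ := fun i => hr (e i : s) (e i : s).2
  refine ⟨⟨J.card, fun i => (e i : s), fun i => r (e i : s), fun i => (hrs i).1, fun i => ?_,
    fun i j hij => ?_⟩, ?_, fun i => (hrs i).2.1.le⟩
  · linarith [(hrs i).2.2]
  · have hne : ((e i : s) : ℂ) ≠ (e j : s) := fun h =>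
      hij (e.injective (Subtype.ext (Subtype.ext h)))
    have hd := hdisj (e i : s).2 (e j : s).2 hne
    by_contra! hlt
    have hlt' : dist ((e i : s) : ℂ) (e j : s) < r (e i : s) + r (e j : s) := hlt
    have := (disjoint_closedBall_closedBall_iff (hrs i).1.le (hrs j).1.le).1 hd
    linarith
  · rw [← ENNReal.ofReal_sum_of_nonneg fun _ _ => sq_nonneg _] at hJ
    have h3 : η ≤ ∑ x ∈ J, r x ^ 2 := (ENNReal.ofReal_lt_ofReal_iff'.1 hJ).1.le
    rw [← Finset.sum_coe_sort, ← Equiv.sum_comp e] at h3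
    exact h3

end DiskPacking

/-! ### Contraction ratios and coding of the Cantor sets -/

namespace DiskPacking

variable (P : DiskPacking)

/-- Contraction ratios attached to the discs of a packing. -/
noncomputable def ratio (α : ℝ) (i : Fin P.card) : ℝ := P.radius i * P.radius i ^ α

/-- All contraction ratios are at most half of the radii. -/
def Fine (α : ℝ) : Prop := ∀ i, P.radius i ^ α ≤ 1 / 2

variable {P} {α : ℝ}

lemma ratio_pos (i : Fin P.card) : 0 < P.ratio α i :=
  mul_pos (P.radius_pos i) (Real.rpow_pos_of_pos (P.radius_pos i) _)

lemma Fine.ratio_le (h : P.Fine α) (i : Fin P.card) : P.ratio α i ≤ P.radius i / 2 := by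
  have := mul_le_mul_of_nonneg_left (h i) (P.radius_pos i).le
  rw [ratio]; linarith

lemma Fine.ratio_le_half (h : P.Fine α) (i : Fin P.card) : P.ratio α i ≤ 1 / 2 := by
  linarith [h.ratio_le i, P.radius_le_one i]

/-- The reason for the choice of `α`: `t`-dimensional size becomes area. -/
lemma ratio_rpow {t : ℝ} (hα : (1 + α) * t = 2) (i : Fin P.card) :
    P.ratio α i ^ t = P.radius i ^ 2 := by
  have h := P.radius_pos i
  have : P.ratio α i = P.radius i ^ (1 + α) := by
    rw [ratio, Real.rpow_add h, Real.rpow_one]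
  rw [this, ← Real.rpow_mul h.le, hα, Real.rpow_two]

end DiskPacking

/-- Infinite words selecting a disc in each packing of a sequence. -/
abbrev Code (P : ℕ → DiskPacking) : Type := ∀ k, Fin (P k).card

section Coding

variable (α : ℝ) (P : ℕ → DiskPacking)

/-- The scale of the `n`-th generation disc selected by a code. -/
noncomputable def scale (w : Code P) (n : ℕ) : ℝ := ∏ k ∈ Finset.range n, (P k).ratio α (w k)

/-- The point of the Cantor set determined by a code. -/
noncomputable def codePoint (w : Code P) : ℂ :=
  ∑' k, (scale α P w k : ℂ) * (P k).center (w k)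

variable {α P}

lemma scale_pos (w : Code P) (n : ℕ) : 0 < scale α P w n :=
  Finset.prod_pos fun _ _ => DiskPacking.ratio_pos _

lemma scale_succ (w : Code P) (n : ℕ) :
    scale α P w (n + 1) = scale α P w n * (P n).ratio α (w n) := Finset.prod_range_succ _ _

lemma scale_congr {w w' : Code P} {n : ℕ} (h : ∀ k < n, w k = w' k) :
    scale α P w n = scale α P w' n :=
  Finset.prod_congr rfl fun k hk => by rw [h k (Finset.mem_range.1 hk)]

lemma scale_add (w : Code P) (n k : ℕ) :
    scale α P w (k + n) =
      scale α P w n * scale α (fun j => P (j + n)) (fun j => w (j + n)) k := by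
  induction k with
  | zero => simp [scale]
  | succ k ih => rw [Nat.succ_add, scale_succ, ih, scale_succ, mul_assoc]

variable (hP : ∀ n, (P n).Fine α)
include hP

lemma scale_le (w : Code P) (n : ℕ) : scale α P w n ≤ (1 / 2) ^ n := by
  have := Finset.prod_le_prod (s := Finset.range n) (f := fun k => (P k).ratio α (w k))
    (g := fun _ => (1 / 2 : ℝ)) (fun k _ => (DiskPacking.ratio_pos _).le)
    (fun k _ => (hP k).ratio_le_half _)
  simpa [scale] using this

/-- Since `‖c‖ ≤ 1 - r` and the ratio is at most `r`, nested discs give a telescoping majorant; it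
keeps the Cantor set in the closed unit disc. -/
lemma norm_term_le (w : Code P) (k : ℕ) :
    ‖(scale α P w k : ℂ) * (P k).center (w k)‖ ≤ scale α P w k - scale α P w (k + 1) := by
  have h1 := (P k).norm_center_add_radius_le (w k)
  have h2 := (hP k).ratio_le (w k)
  have h3 := (P k).radius_pos (w k)
  have h4 := scale_pos (α := α) w k
  rw [norm_mul, Complex.norm_real, Real.norm_of_nonneg h4.le, scale_succ, ← mul_one_sub]
  gcongr
  linarith

lemma norm_term_le_half_pow (w : Code P) (k : ℕ) :
    ‖(scale α P w k : ℂ) * (P k).center (w k)‖ ≤ (1 / 2) ^ k :=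
  (norm_term_le hP w k).trans (by linarith [scale_pos (α := α) w (k + 1), scale_le hP w k])

lemma summable_term (w : Code P) :
    Summable fun k => (scale α P w k : ℂ) * (P k).center (w k) :=
  .of_norm_bounded summable_geometric_two fun k => norm_term_le_half_pow hP w k

lemma norm_codePoint_le_one (w : Code P) : ‖codePoint α P w‖ ≤ 1 := by
  have h := (summable_term hP w).hasSum.tendsto_sum_nat.norm
  refine le_of_tendsto h (Eventually.of_forall fun n => ?_)
  calc ‖∑ k ∈ Finset.range n, (scale α P w k : ℂ) * (P k).center (w k)‖
      ≤ ∑ k ∈ Finset.range n, (scale α P w k - scale α P w (k + 1)) :=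
        norm_sum_le_of_le _ fun k _ => norm_term_le hP w k
    _ = 1 - scale α P w n := by rw [Finset.sum_range_sub']; simp [scale]
    _ ≤ 1 := by linarith [scale_pos (α := α) w n]

lemma continuous_codePoint : Continuous (codePoint α P) := by
  refine continuous_tsum (fun k => ?_) summable_geometric_two
    fun k w => norm_term_le_half_pow hP w k
  refine (Complex.continuous_ofReal.comp (continuous_finsetProd _ fun j _ => ?_)).mul ?_
  · exact (continuous_of_discreteTopology (f := (P j).ratio α)).comp (continuous_apply j)
  · exact (continuous_of_discreteTopology (f := (P k).center)).comp (continuous_apply k)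

lemma codePoint_eq_add (w : Code P) (n : ℕ) :
    codePoint α P w = ∑ k ∈ Finset.range n, (scale α P w k : ℂ) * (P k).center (w k) +
      scale α P w n * codePoint α (fun j => P (j + n)) (fun j => w (j + n)) := by
  rw [codePoint, ← (summable_term hP w).sum_add_tsum_nat_add n, codePoint, ← tsum_mul_left]
  congr 2
  ext k
  rw [scale_add]
  push_cast
  ring

lemma codePoint_eq_head (w : Code P) :
    codePoint α P w = (P 0).center (w 0) +
      (P 0).ratio α (w 0) * codePoint α (fun j => P (j + 1)) (fun j => w (j + 1)) := by
  rw [codePoint_eq_add hP w 1]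
  simp [scale]

/-- A common prefix acts by one similarity, so questions about separation reduce to the first letter
of a shifted sequence. -/
lemma dist_codePoint_of_agree {w w' : Code P} {n : ℕ} (h : ∀ k < n, w k = w' k) :
    dist (codePoint α P w) (codePoint α P w') = scale α P w n *
      dist (codePoint α (fun j => P (j + n)) (fun j => w (j + n)))
        (codePoint α (fun j => P (j + n)) (fun j => w' (j + n))) := by
  rw [codePoint_eq_add hP w n, codePoint_eq_add hP w' n, ← scale_congr h]
  have : ∑ k ∈ Finset.range n, (scale α P w k : ℂ) * (P k).center (w k) =
      ∑ k ∈ Finset.range n, (scale α P w' k : ℂ) * (P k).center (w' k) :=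
    Finset.sum_congr rfl fun k hk => by
      rw [h k (Finset.mem_range.1 hk),
        scale_congr fun j hj => h j (hj.trans (Finset.mem_range.1 hk))]
  rw [this, dist_add_left, dist_eq_norm, dist_eq_norm, ← mul_sub, norm_mul, Complex.norm_real,
    Real.norm_of_nonneg (scale_pos _ _).le]

lemma dist_codePoint_center_le (w : Code P) :
    dist ((P 0).center (w 0)) (codePoint α P w) ≤ (P 0).radius (w 0) / 2 := by
  rw [codePoint_eq_head hP, dist_self_add_right, norm_mul, Complex.norm_real,
    Real.norm_of_nonneg (DiskPacking.ratio_pos _).le]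
  have h1 := norm_codePoint_le_one (fun j => hP (j + 1)) (fun j => w (j + 1))
  have h2 := (hP 0).ratio_le (w 0)
  have h3 := DiskPacking.ratio_pos (α := α) (w 0)
  nlinarith

/-- `Fine` confines each piece to the concentric disc of half the radius, which leaves a gap
comparable to both radii. -/
lemma radius_add_radius_le_dist_codePoint {w w' : Code P} (h : w 0 ≠ w' 0) :
    ((P 0).radius (w 0) + (P 0).radius (w' 0)) / 2 ≤
      dist (codePoint α P w) (codePoint α P w') := by
  have h1 := dist_codePoint_center_le hP w
  have h2 := dist_codePoint_center_le hP w'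
  have h3 := (P 0).radius_add_radius_le _ _ h
  have h4 := dist_triangle4 ((P 0).center (w 0)) (codePoint α P w) (codePoint α P w')
    ((P 0).center (w' 0))
  rw [dist_comm ((P 0).center (w' 0))] at h2
  linarith

/-- The discs selected by a set of codes whose points lie within distance `ρ` of each other have
total mass at most `25 ρ ^ t`. -/
lemma sum_sq_le_of_dist_le {t : ℝ} (ht0 : 0 < t) (ht2 : t < 2) {A : Set (Code P)} {ρ : ℝ}
    (hA : ∃ w ∈ A, ∃ w' ∈ A, w 0 ≠ w' 0)
    (hρ : ∀ w ∈ A, ∀ w' ∈ A, dist (codePoint α P w) (codePoint α P w') ≤ ρ)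
    {J : Finset (Fin (P 0).card)} (hJ : ∀ i ∈ J, ∃ w ∈ A, w 0 = i) :
    ∑ i ∈ J, (P 0).radius i ^ 2 ≤ 25 * ρ ^ t := by
  obtain ⟨w₀, h₀, w₁, h₁, hne⟩ := hA
  have hρ0 : 0 < ρ := by
    have h1 := radius_add_radius_le_dist_codePoint hP hne
    have h2 := hρ _ h₀ _ h₁
    linarith [(P 0).radius_pos (w₀ 0), (P 0).radius_pos (w₁ 0)]
  have hrad : ∀ w ∈ A, (P 0).radius (w 0) ≤ 2 * ρ := by
    intro w hw
    have : ∃ w' ∈ A, w 0 ≠ w' 0 := by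
      by_cases h : w 0 = w₀ 0
      · exact ⟨w₁, h₁, h ▸ hne⟩
      · exact ⟨w₀, h₀, h⟩
    obtain ⟨w', hw', hne'⟩ := this
    have h1 := radius_add_radius_le_dist_codePoint hP hne'
    have h2 := hρ _ hw _ hw'
    linarith [(P 0).radius_pos (w' 0)]
  rcases le_or_gt ρ 1 with h | h
  -- A selected disc has radius at most `2 * ρ` and its centre is within `ρ` plus half its radius of
  -- the base point. It thus lies within `4 * ρ`; the factor `5` has slack.
  · have hle : ∑ i ∈ J, (P 0).radius i ^ 2 ≤ (5 * ρ) ^ 2 := by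
      refine (P 0).sum_sq_le (x := codePoint α P w₀) (by positivity) fun i hi => ?_
      obtain ⟨w, hw, rfl⟩ := hJ i hi
      have h1 := dist_codePoint_center_le hP w
      have h2 := hρ _ hw _ h₀
      have h3 := hrad _ hw
      linarith [dist_triangle ((P 0).center (w 0)) (codePoint α P w) (codePoint α P w₀)]
    have h2 : ρ ^ (2 : ℝ) ≤ ρ ^ t := Real.rpow_le_rpow_of_exponent_ge hρ0 h ht2.le
    rw [Real.rpow_two] at h2
    nlinarith
  -- For large `ρ` the comparison of `ρ ^ 2` with `ρ ^ t` fails, but the total mass is at most `1`.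
  · have h1 : ∑ i ∈ J, (P 0).radius i ^ 2 ≤ 1 :=
      (Finset.sum_le_sum_of_subset_of_nonneg (Finset.subset_univ J)
        fun _ _ _ => sq_nonneg _).trans (P 0).mass_le_one
    have h2 : 1 ≤ ρ ^ t := Real.one_le_rpow h.le ht0.le
    linarith

end Coding

/-! ### The natural measure and the Hausdorff measure bounds -/

namespace DiskPacking

/-- The probability measure on the discs of a packing proportional to area. -/
noncomputable def weight (P : DiskPacking) : Measure (Fin P.card) :=
  ∑ i, ENNReal.ofReal (P.radius i ^ 2 / P.mass) • Measure.dirac i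

variable {P : DiskPacking}

lemma weight_apply (hm : 0 < P.mass) (J : Finset (Fin P.card)) :
    P.weight J = ENNReal.ofReal ((∑ i ∈ J, P.radius i ^ 2) / P.mass) := by
  rw [Finset.sum_div, ENNReal.ofReal_sum_of_nonneg fun _ _ => by positivity]
  simp [weight, Measure.finsetSum_apply, Set.indicator_apply, Finset.sum_ite_mem]

lemma weight_singleton (hm : 0 < P.mass) (i : Fin P.card) :
    P.weight {i} = ENNReal.ofReal (P.radius i ^ 2 / P.mass) := by
  simpa using weight_apply hm {i}

lemma isProbabilityMeasure_weight (hm : 0 < P.mass) : IsProbabilityMeasure P.weight := by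
  refine ⟨?_⟩
  have := weight_apply hm Finset.univ
  rw [Finset.coe_univ] at this
  rw [this, ← mass, div_self hm.ne', ENNReal.ofReal_one]

end DiskPacking

section Hausdorff

variable {α t c : ℝ} {P : ℕ → DiskPacking}

/-- Enclosing a set in the box of its projections loses little here: it is applied with all
coordinates but possibly the last one constant. -/
lemma infinitePi_le_prod {X : ℕ → Type*} [∀ k, MeasurableSpace (X k)]
    [∀ k, MeasurableSingletonClass (X k)] [∀ k, Countable (X k)] (μ : ∀ k, Measure (X k))
    [∀ k, IsProbabilityMeasure (μ k)] (A : Set (∀ k, X k)) (n : ℕ) :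
    Measure.infinitePi μ A ≤ ∏ k ∈ Finset.range n, μ k ((fun w : ∀ k, X k => w k) '' A) := by
  rw [← Measure.infinitePi_pi μ fun k _ => (Set.to_countable _).measurableSet]
  exact measure_mono fun w hw k _ => mem_image_of_mem _ hw

lemma scale_rpow (hα : (1 + α) * t = 2) (w : Code P) (n : ℕ) :
    scale α P w n ^ t = ∏ k ∈ Finset.range n, (P k).radius (w k) ^ 2 := by
  rw [scale, ← Real.finsetProd_rpow _ _ fun _ _ => (DiskPacking.ratio_pos _).le]
  exact Finset.prod_congr rfl fun k _ => DiskPacking.ratio_rpow hα _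

lemma mass_pos (hc : 0 < c) (hm : ∀ n, c ≤ ∏ k ∈ Finset.range n, (P k).mass) (n : ℕ) :
    0 < (P n).mass := by
  have h1 : 0 ≤ (P n).mass := Finset.sum_nonneg fun _ _ => sq_nonneg _
  refine h1.lt_of_ne fun h => ?_
  have := hm (n + 1)
  rw [Finset.prod_range_succ, ← h, mul_zero] at this
  linarith

lemma prod_weight_le (hα : (1 + α) * t = 2) (hc : 0 < c)
    (hm : ∀ n, c ≤ ∏ k ∈ Finset.range n, (P k).mass) {A : Set (Code P)} {w : Code P} {n : ℕ}
    (hA : ∀ k < n, ∀ w' ∈ A, w' k = w k) :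
    ∏ k ∈ Finset.range n, (P k).weight ((fun w : Code P => w k) '' A) ≤
      ENNReal.ofReal (scale α P w n ^ t / ∏ k ∈ Finset.range n, (P k).mass) := by
  rw [scale_rpow hα, ← Finset.prod_div_distrib,
    ENNReal.ofReal_prod_of_nonneg fun k _ => div_nonneg (sq_nonneg _) (mass_pos hc hm k).le]
  refine Finset.prod_le_prod' fun k hk => ?_
  rw [← DiskPacking.weight_singleton (mass_pos hc hm k)]
  refine measure_mono ?_
  rintro _ ⟨w', hw', rfl⟩
  exact hA k (Finset.mem_range.1 hk) w' hw'

variable (hP : ∀ n, (P n).Fine α)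
include hP

lemma infinitePi_weight_singleton (ht0 : 0 < t) (hα : (1 + α) * t = 2) (hc : 0 < c)
    (hm : ∀ n, c ≤ ∏ k ∈ Finset.range n, (P k).mass) (w : Code P) :
    Measure.infinitePi (fun k => (P k).weight) {w} = 0 := by
  have := fun k => DiskPacking.isProbabilityMeasure_weight (mass_pos hc hm k)
  have hlim : Tendsto (fun n : ℕ => ENNReal.ofReal ((((1 / 2 : ℝ) ^ t) ^ n) / c)) atTop (𝓝 0) := by
    have h := tendsto_pow_atTop_nhds_zero_of_lt_one (r := (1 / 2 : ℝ) ^ t) (by positivity)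
      (Real.rpow_lt_one (by norm_num) (by norm_num) ht0)
    simpa using ENNReal.tendsto_ofReal (h.div_const c)
  refine le_antisymm (ge_of_tendsto' hlim fun n => ?_) zero_le
  refine (infinitePi_le_prod _ _ n).trans ((prod_weight_le hα hc hm (w := w) ?_).trans ?_)
  · rintro k _ w' rfl; rfl
  · refine ENNReal.ofReal_le_ofReal (div_le_div₀ (by positivity) ?_ hc (hm n))
    rw [← Real.rpow_natCast, ← Real.rpow_mul (by norm_num), mul_comm, Real.rpow_mul (by norm_num),
      Real.rpow_natCast]
    exact Real.rpow_le_rpow (scale_pos _ _).le (scale_le hP w n) ht0.le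

/-- The natural measure on codes satisfies a Frostman condition. -/
lemma infinitePi_weight_preimage_le (ht0 : 0 < t) (ht2 : t < 2) (hα : (1 + α) * t = 2)
    (hc : 0 < c) (hm : ∀ n, c ≤ ∏ k ∈ Finset.range n, (P k).mass) {U : Set ℂ}
    (hU : Bornology.IsBounded U) :
    Measure.infinitePi (fun k => (P k).weight) (codePoint α P ⁻¹' U) ≤
      ENNReal.ofReal (25 / c * diam U ^ t) := by
  have := fun k => DiskPacking.isProbabilityMeasure_weight (mass_pos hc hm k)
  set A := codePoint α P ⁻¹' U
  by_cases hagree : ∀ n, ∀ w ∈ A, ∀ w' ∈ A, w n = w' n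
  · have hsub : A.Subsingleton := fun w hw w' hw' => funext fun n => hagree n w hw w' hw'
    rcases hsub.eq_empty_or_singleton with h | ⟨w, h⟩
    · simp [h]
    · rw [h, infinitePi_weight_singleton hP ht0 hα hc hm]
      exact zero_le
  classical
  push Not at hagree
  -- The first coordinate at which the codes over `U` split. Below it the measure of a cylinder is
  -- essentially `scale ^ t`.
  let n := Nat.find hagree
  obtain ⟨w, hw, w', hw', hne⟩ := Nat.find_spec hagree
  have hlt : ∀ k < n, ∀ v ∈ A, v k = w k := by
    intro k hk v hv
    have := Nat.find_min hagree hk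
    push Not at this
    exact this v hv w hw
  set ρ := diam U / scale α P w n
  have hs := scale_pos (α := α) w n
  let J : Finset (Fin (P n).card) := Finset.univ.filter fun i => i ∈ (fun w : Code P => w n) '' A
  have hJ : ((fun w : Code P => w n) '' A) = J := by ext; simp [J]
  -- Stated for a variable `m` so that substituting `0 + n` matches the dependent type of the first
  -- packing of the shifted sequence.
  have hshift : ∀ m, m = 0 + n → ∀ I : Finset (Fin (P m).card), (∀ i ∈ I, ∃ v ∈ A, v m = i) →
      w m ≠ w' m → ∑ i ∈ I, (P m).radius i ^ 2 ≤ 25 * ρ ^ t := by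
    rintro _ rfl I hI hne
    refine sum_sq_le_of_dist_le (P := fun j => P (j + n)) (fun j => hP (j + n)) ht0 ht2
      (A := (fun w : Code P => fun j => w (j + n)) '' A) (ρ := ρ)
      ⟨_, ⟨w, hw, rfl⟩, _, ⟨w', hw', rfl⟩, hne⟩ ?_ fun i hi => ?_
    · rintro _ ⟨v, hv, rfl⟩ _ ⟨v', hv', rfl⟩
      have hvv : ∀ k < n, v k = v' k := fun k hk => by rw [hlt k hk v hv, hlt k hk v' hv']
      have h1 := dist_codePoint_of_agree hP hvv
      rw [scale_congr fun k hk => hlt k hk v hv] at h1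
      have h2 := dist_le_diam_of_mem hU hv hv'
      rw [le_div_iff₀ hs, mul_comm]
      exact h1 ▸ h2
    · obtain ⟨v, hv, rfl⟩ := hI i hi
      exact ⟨_, ⟨v, hv, rfl⟩, rfl⟩
  have hsum : ∑ i ∈ J, (P n).radius i ^ 2 ≤ 25 * ρ ^ t :=
    hshift n (zero_add n).symm J (fun i hi => (Finset.mem_filter.1 hi).2) hne
  refine (infinitePi_le_prod _ _ (n + 1)).trans ?_
  rw [Finset.prod_range_succ, hJ, DiskPacking.weight_apply (mass_pos hc hm n)]
  refine (mul_le_mul_left (prod_weight_le hα hc hm hlt) _).trans ?_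
  rw [← ENNReal.ofReal_mul (div_nonneg (by positivity)
    (Finset.prod_nonneg fun k _ => (mass_pos hc hm k).le))]
  refine ENNReal.ofReal_le_ofReal ?_
  rw [div_mul_div_comm, ← Finset.prod_range_succ]
  calc _ ≤ scale α P w n ^ t * (25 * ρ ^ t) / c :=
        div_le_div₀ (by positivity) (by gcongr) hc (hm _)
    _ = 25 / c * (scale α P w n * ρ) ^ t := by
        rw [Real.mul_rpow hs.le (by positivity)]; ring
    _ = _ := by rw [mul_div_cancel₀ _ hs.ne']

theorem hausdorffMeasure_range_codePoint_pos (ht0 : 0 < t) (ht2 : t < 2)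
    (hα : (1 + α) * t = 2) (hc : 0 < c) (hm : ∀ n, c ≤ ∏ k ∈ Finset.range n, (P k).mass) :
    0 < Measure.hausdorffMeasure t (range (codePoint α P)) := by
  have := fun k => DiskPacking.isProbabilityMeasure_weight (mass_pos hc hm k)
  have hmeas : Measurable (codePoint α P) := (continuous_codePoint hP).measurable
  set ν := (Measure.infinitePi fun k => (P k).weight).map (codePoint α P)
  set C := ENNReal.ofReal (25 / c)
  have hC0 : C ≠ 0 := by simp [C, hc]
  have hCt : C ≠ ⊤ := ENNReal.ofReal_ne_top
  have hle : C⁻¹ • ν ≤ Measure.hausdorffMeasure t := by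
    -- Mass distribution principle. The threshold `1` serves only to make `U` bounded; the closure
    -- makes the set measurable without changing its diameter.
    refine Measure.le_hausdorffMeasure t _ 1 one_pos fun U hU => ?_
    have hb : Bornology.IsBounded (closure U) :=
      (isBounded_iff_ediam_ne_top.2 (hU.trans_lt ENNReal.one_lt_top).ne).closure
    have h1 : ν (closure U) ≤ C * ediam U ^ t := by
      rw [Measure.map_apply hmeas isClosed_closure.measurableSet]
      refine (infinitePi_weight_preimage_le hP ht0 ht2 hα hc hm hb).trans_eq ?_
      rw [ENNReal.ofReal_mul (by positivity), ← ENNReal.ofReal_rpow_of_nonneg diam_nonneg ht0.le,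
        diam, ENNReal.ofReal_toReal hb.ediam_ne_top, ediam_closure]
    calc (C⁻¹ • ν) U ≤ C⁻¹ * ν (closure U) := by
          rw [Measure.smul_apply, smul_eq_mul]
          gcongr
          exact subset_closure
      _ ≤ C⁻¹ * (C * ediam U ^ t) := by gcongr
      _ = _ := by rw [← mul_assoc, ENNReal.inv_mul_cancel hC0 hCt, one_mul]
  refine lt_of_lt_of_le ?_ (hle _)
  have h1 : ν (range (codePoint α P)) = 1 := by
    rw [Measure.map_apply hmeas (isCompact_range (continuous_codePoint hP)).measurableSet,
      preimage_range, measure_univ]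
  rw [Measure.smul_apply, h1, smul_eq_mul, mul_one]
  exact ENNReal.inv_pos.2 hCt

/-- Generation `n` consists of pieces of diameter at most twice their scale. Their `t`-th powers sum
to at most `2 ^ t` times a product of masses, each at most `1`. -/
theorem hausdorffMeasure_range_codePoint_lt_top (ht0 : 0 < t) (hα : (1 + α) * t = 2) :
    Measure.hausdorffMeasure t (range (codePoint α P)) < ⊤ := by
  classical
  let piece (n : ℕ) (v : ∀ k : Fin n, Fin (P k).card) : Set ℂ :=
    codePoint α P '' {w | ∀ k : Fin n, w k = v k}
  let s (n : ℕ) (v : ∀ k : Fin n, Fin (P k).card) : ℝ := ∏ k : Fin n, (P k).ratio α (v k)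
  have hs0 : ∀ n v, 0 ≤ s n v := fun n v =>
    Finset.prod_nonneg fun _ _ => (DiskPacking.ratio_pos _).le
  have hs1 : ∀ n v, s n v ≤ (1 / 2) ^ n := fun n v => by
    have := Finset.prod_le_prod (s := Finset.univ) (f := fun k : Fin n => (P k).ratio α (v k))
      (g := fun _ => (1 / 2 : ℝ)) (fun k _ => (DiskPacking.ratio_pos _).le)
      (fun k _ => (hP k).ratio_le_half _)
    simpa using this
  have hdiam : ∀ n v, ediam (piece n v) ≤ ENNReal.ofReal (2 * s n v) := by
    intro n v
    refine ediam_le ?_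
    rintro _ ⟨w, hw, rfl⟩ _ ⟨w', hw', rfl⟩
    rw [edist_dist]
    refine ENNReal.ofReal_le_ofReal ?_
    have hww : ∀ k < n, w k = w' k := fun k hk => (hw ⟨k, hk⟩).trans (hw' ⟨k, hk⟩).symm
    have hsc : scale α P w n = s n v := by
      rw [scale, Finset.prod_range]
      exact Finset.prod_congr rfl fun k _ => by rw [hw k]
    rw [dist_codePoint_of_agree hP hww, hsc, mul_comm]
    refine mul_le_mul_of_nonneg_right ?_ (hs0 n v)
    rw [dist_eq_norm]
    refine (norm_sub_le _ _).trans ?_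
    linarith [norm_codePoint_le_one (fun j => hP (j + n)) fun j => w (j + n),
      norm_codePoint_le_one (fun j => hP (j + n)) fun j => w' (j + n)]
  have hlim : Tendsto (fun n : ℕ => ENNReal.ofReal (2 * (1 / 2) ^ n)) atTop (𝓝 0) := by
    have h := tendsto_pow_atTop_nhds_zero_of_lt_one (r := (1 / 2 : ℝ)) (by norm_num) (by norm_num)
    simpa using ENNReal.tendsto_ofReal (h.const_mul 2)
  refine (Measure.hausdorffMeasure_le_liminf_sum t _ _ hlim piece (.of_forall fun n v => ?_)
    (.of_forall fun n => ?_)).trans_lt ?_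
  · refine (hdiam n v).trans (ENNReal.ofReal_le_ofReal ?_)
    linarith [hs1 n v]
  · rintro _ ⟨w, rfl⟩
    exact mem_iUnion.2 ⟨fun k => w k, w, fun _ => rfl, rfl⟩
  · refine lt_of_le_of_lt (b := ENNReal.ofReal (2 ^ t)) ?_ ENNReal.ofReal_lt_top
    refine (liminf_le_liminf (v := fun _ => ENNReal.ofReal (2 ^ t)) (.of_forall fun n => ?_)).trans
      (liminf_const _).le
    calc ∑ v, ediam (piece n v) ^ t
        ≤ ∑ v : ∀ k : Fin n, Fin (P k).card,
            ENNReal.ofReal (2 ^ t * ∏ k : Fin n, (P k).radius (v k) ^ 2) := by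
          refine Finset.sum_le_sum fun v _ => ?_
          refine (ENNReal.rpow_le_rpow (hdiam n v) ht0.le).trans_eq ?_
          rw [ENNReal.ofReal_rpow_of_nonneg (mul_nonneg zero_le_two (hs0 n v)) ht0.le,
            Real.mul_rpow zero_le_two (hs0 n v),
            ← Real.finsetProd_rpow _ _ fun _ _ => (DiskPacking.ratio_pos _).le]
          simp only [DiskPacking.ratio_rpow hα]
      _ = ENNReal.ofReal (2 ^ t * ∏ k : Fin n, (P k).mass) := by
          rw [← ENNReal.ofReal_sum_of_nonneg fun _ _ => by positivity, ← Finset.mul_sum]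
          simp only [DiskPacking.mass, Finset.prod_univ_sum, Fintype.piFinset_univ]
      _ ≤ ENNReal.ofReal (2 ^ t) := by
          refine ENNReal.ofReal_le_ofReal (mul_le_of_le_one_right (by positivity) ?_)
          exact Finset.prod_le_one (fun _ _ => Finset.sum_nonneg fun _ _ => sq_nonneg _)
            fun k _ => (P k).mass_le_one

end Hausdorff

/-! ### Radial stretching and insertion of a disc map -/

section Stretch

variable {a p : ℝ}

/-- The radial map `z ↦ ‖z‖ ^ (p - 1) • z` on the annulus `a ≤ ‖z‖ ≤ 1`, extended by the identity
outside and linearly inside. -/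
noncomputable def stretch (a p : ℝ) (z : ℂ) : ℂ := (max a (min 1 ‖z‖)) ^ (p - 1) • z

lemma stretch_of_le (ha1 : a ≤ 1) {z : ℂ} (hz : ‖z‖ ≤ a) : stretch a p z = a ^ (p - 1) • z := by
  rw [stretch, min_eq_right (hz.trans ha1), max_eq_left hz]

lemma stretch_of_one_le (ha1 : a ≤ 1) {z : ℂ} (hz : 1 ≤ ‖z‖) : stretch a p z = z := by
  rw [stretch, min_eq_left hz, max_eq_right ha1, Real.one_rpow, one_smul]

lemma stretch_of_mem {z : ℂ} (hz : a ≤ ‖z‖) (hz1 : ‖z‖ ≤ 1) :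
    stretch a p z = ‖z‖ ^ (p - 1) • z := by
  rw [stretch, min_eq_right hz1, max_eq_right hz]

lemma norm_stretch_of_mem (ha0 : 0 < a) {z : ℂ} (hz : a ≤ ‖z‖) (hz1 : ‖z‖ ≤ 1) :
    ‖stretch a p z‖ = ‖z‖ ^ p := by
  have h0 : 0 < ‖z‖ := ha0.trans_le hz
  rw [stretch_of_mem hz hz1, norm_smul, Real.norm_of_nonneg (by positivity),
    Real.rpow_sub_one h0.ne', div_mul_cancel₀ _ h0.ne']

lemma norm_stretch_of_le (ha0 : 0 < a) (ha1 : a ≤ 1) {z : ℂ} (hz : ‖z‖ ≤ a) :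
    ‖stretch a p z‖ ≤ a ^ p := by
  rw [stretch_of_le ha1 hz, norm_smul, Real.norm_of_nonneg (by positivity),
    Real.rpow_sub_one ha0.ne', div_mul_eq_mul_div, div_le_iff₀ ha0]
  gcongr

lemma norm_stretch_le_one (ha0 : 0 < a) (ha1 : a ≤ 1) (hp : 0 < p) {z : ℂ} (hz : ‖z‖ ≤ 1) :
    ‖stretch a p z‖ ≤ 1 := by
  rcases le_total ‖z‖ a with h | h
  · exact (norm_stretch_of_le ha0 ha1 h).trans (Real.rpow_le_one ha0.le ha1 hp.le)
  · rw [norm_stretch_of_mem ha0 h hz]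
    exact Real.rpow_le_one (norm_nonneg _) hz hp.le

lemma rpow_le_norm_stretch (ha0 : 0 < a) (ha1 : a ≤ 1) (hp : 0 < p) {z : ℂ} (hz : a ≤ ‖z‖) :
    a ^ p ≤ ‖stretch a p z‖ := by
  rcases le_total ‖z‖ 1 with h | h
  · rw [norm_stretch_of_mem ha0 hz h]
    gcongr
  · rw [stretch_of_one_le ha1 h]
    exact (Real.rpow_le_one ha0.le ha1 hp.le).trans h

/-- The inverse belongs to the same family, with inner radius `a ^ p` and exponent `p⁻¹`, so
inverses need no separate construction. -/
lemma stretch_inv_stretch (ha0 : 0 < a) (ha1 : a ≤ 1) (hp : 0 < p) (z : ℂ) :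
    stretch (a ^ p) p⁻¹ (stretch a p z) = z := by
  have hb1 : a ^ p ≤ 1 := Real.rpow_le_one ha0.le ha1 hp.le
  rcases le_total ‖z‖ a with h | h
  · rw [stretch_of_le hb1 (norm_stretch_of_le ha0 ha1 h), stretch_of_le ha1 h, smul_smul,
      ← Real.rpow_mul ha0.le, ← Real.rpow_add ha0]
    have : p * (p⁻¹ - 1) + (p - 1) = 0 := by field_simp; ring
    rw [this, Real.rpow_zero, one_smul]
  rcases le_total ‖z‖ 1 with h1 | h1
  · have h0 : 0 < ‖z‖ := ha0.trans_le h
    rw [stretch_of_mem (rpow_le_norm_stretch ha0 ha1 hp h) (norm_stretch_le_one ha0 ha1 hp h1),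
      norm_stretch_of_mem ha0 h h1, stretch_of_mem h h1, smul_smul,
      ← Real.rpow_mul h0.le, ← Real.rpow_add h0]
    have : p * (p⁻¹ - 1) + (p - 1) = 0 := by field_simp; ring
    rw [this, Real.rpow_zero, one_smul]
  · rw [stretch_of_one_le ha1 h1, stretch_of_one_le hb1 h1]

lemma exists_norm_stretch_sub_le (ha0 : 0 < a) (p : ℝ) :
    ∃ C : ℝ, 0 ≤ C ∧ ∀ z w, ‖stretch a p z - stretch a p w‖ ≤ C * ‖z - w‖ := by
  obtain ⟨L, hL⟩ : ∃ L, LipschitzOnWith L (fun r : ℝ => r ^ (p - 1)) (Icc a (max a 1)) := by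
    refine LocallyLipschitzOn.exists_lipschitzOnWith_of_compact isCompact_Icc fun x hx => ?_
    obtain ⟨L, t, ht, h⟩ := (Real.contDiffAt_rpow_const_of_ne (p := p - 1) (n := 1)
      (ha0.trans_le hx.1).ne').exists_lipschitzOnWith
    exact ⟨L, t, nhdsWithin_le_nhds ht, h⟩
  obtain ⟨B, hB⟩ : ∃ B, ∀ r ∈ Icc a (max a 1), ‖r ^ (p - 1)‖ ≤ B :=
    isCompact_Icc.exists_bound_of_continuousOn hL.continuousOn
  have hmem : ∀ z : ℂ, max a (min 1 ‖z‖) ∈ Icc a (max a 1) := fun z =>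
    ⟨le_max_left _ _, max_le_max le_rfl (min_le_left _ _)⟩
  have hB0 : 0 ≤ B := (norm_nonneg _).trans (hB _ (hmem 0))
  have key : ∀ z w : ℂ, ‖z‖ ≤ ‖w‖ → ‖stretch a p z - stretch a p w‖ ≤ (B + L) * ‖z - w‖ := by
    intro z w hzw
    -- The difference of multipliers is paired with the point of smaller norm: either that norm is
    -- at most `1`, or both multipliers are `1`.
    have hsplit : stretch a p z - stretch a p w = (max a (min 1 ‖w‖)) ^ (p - 1) • (z - w) +
        ((max a (min 1 ‖z‖)) ^ (p - 1) - (max a (min 1 ‖w‖)) ^ (p - 1)) • z := by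
      rw [stretch, stretch]; module
    have h1 : ‖(max a (min 1 ‖w‖)) ^ (p - 1) • (z - w)‖ ≤ B * ‖z - w‖ := by
      rw [norm_smul]
      exact mul_le_mul_of_nonneg_right (hB _ (hmem w)) (norm_nonneg _)
    have h2 : ‖((max a (min 1 ‖z‖)) ^ (p - 1) - (max a (min 1 ‖w‖)) ^ (p - 1)) • z‖
        ≤ L * ‖z - w‖ := by
      rw [norm_smul]
      rcases le_total ‖z‖ 1 with h | h
      · have h3 := hL.norm_sub_le (hmem z) (hmem w)
        have h4 : ‖max a (min 1 ‖z‖) - max a (min 1 ‖w‖)‖ ≤ ‖z - w‖ := by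
          have h5 := abs_max_sub_max_le_abs (min 1 ‖z‖) (min 1 ‖w‖) a
          have h6 := abs_min_sub_min_le_max 1 ‖z‖ 1 ‖w‖
          rw [max_comm a, max_comm a]
          refine h5.trans (h6.trans ?_)
          rw [sub_self, abs_zero, max_eq_right (abs_nonneg _)]
          exact abs_norm_sub_norm_le z w
        calc _ ≤ ‖(max a (min 1 ‖z‖)) ^ (p - 1) - (max a (min 1 ‖w‖)) ^ (p - 1)‖ * 1 := by
              gcongr
          _ ≤ L * ‖z - w‖ := by
              rw [mul_one]
              exact h3.trans (by gcongr)
      · rw [min_eq_left h, min_eq_left (h.trans hzw), sub_self, norm_zero, zero_mul]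
        positivity
    rw [hsplit, add_mul]
    exact (norm_add_le _ _).trans (add_le_add h1 h2)
  refine ⟨B + L, by positivity, fun z w => ?_⟩
  rcases le_total ‖z‖ ‖w‖ with h | h
  · exact key z w h
  · rw [norm_sub_rev, norm_sub_rev z]
    exact key w z h

/-- A Lipschitz map of the plane that is the identity off the unit disc and preserves that disc. -/
structure IsDiscMap (f : ℂ → ℂ) : Prop where
  eq_self : ∀ z, 1 ≤ ‖z‖ → f z = z
  norm_le : ∀ z, ‖z‖ ≤ 1 → ‖f z‖ ≤ 1
  lipschitz : ∃ C : ℝ, 0 ≤ C ∧ ∀ z w, ‖f z - f w‖ ≤ C * ‖z - w‖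

lemma IsDiscMap.id : IsDiscMap id where
  eq_self _ _ := rfl
  norm_le _ h := h
  lipschitz := ⟨1, zero_le_one, fun z w => by simp⟩

/-- A disc map shrunk to the disc of radius `a` and followed by a radial stretching. -/
noncomputable def block (a p : ℝ) (f : ℂ → ℂ) (z : ℂ) : ℂ := stretch a p (a • f (a⁻¹ • z))

variable {f g : ℂ → ℂ}

lemma one_le_norm_inv_smul (ha0 : 0 < a) {z : ℂ} : 1 ≤ ‖a⁻¹ • z‖ ↔ a ≤ ‖z‖ := by
  rw [norm_smul, norm_inv, Real.norm_of_nonneg ha0.le, le_inv_mul_iff₀ ha0, mul_one]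

lemma norm_inv_smul_le_one (ha0 : 0 < a) {z : ℂ} : ‖a⁻¹ • z‖ ≤ 1 ↔ ‖z‖ ≤ a := by
  rw [norm_smul, norm_inv, Real.norm_of_nonneg ha0.le, inv_mul_le_iff₀ ha0, mul_one]

lemma IsDiscMap.smul_of_le (hf : IsDiscMap f) (ha0 : 0 < a) {z : ℂ} (hz : a ≤ ‖z‖) :
    a • f (a⁻¹ • z) = z := by
  rw [hf.eq_self _ ((one_le_norm_inv_smul ha0).2 hz), smul_inv_smul₀ ha0.ne']

lemma IsDiscMap.norm_smul_le (hf : IsDiscMap f) (ha0 : 0 < a) {z : ℂ} (hz : ‖z‖ ≤ a) :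
    ‖a • f (a⁻¹ • z)‖ ≤ a := by
  rw [norm_smul, Real.norm_of_nonneg ha0.le]
  exact mul_le_of_le_one_right ha0.le (hf.norm_le _ ((norm_inv_smul_le_one ha0).2 hz))

lemma IsDiscMap.block_of_le (hf : IsDiscMap f) (ha0 : 0 < a) {z : ℂ} (hz : a ≤ ‖z‖) :
    block a p f z = stretch a p z := by
  rw [block, hf.smul_of_le ha0 hz]

lemma IsDiscMap.block_of_norm_le (hf : IsDiscMap f) (ha0 : 0 < a) (ha1 : a ≤ 1) {z : ℂ}
    (hz : ‖z‖ ≤ a) : block a p f z = a ^ p • f (a⁻¹ • z) := by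
  rw [block, stretch_of_le ha1 (hf.norm_smul_le ha0 hz), smul_smul, Real.rpow_sub_one ha0.ne',
    div_mul_cancel₀ _ ha0.ne']

/-- The stretch is linear on the inner disc, so inserting `f` before it at radius `a` equals
inserting `f` after it at radius `a ^ p`. This makes `block` invertible within its family. -/
lemma IsDiscMap.block_eq_comp_stretch (hf : IsDiscMap f) (ha0 : 0 < a) (ha1 : a ≤ 1)
    (hp : 0 < p) (z : ℂ) : block a p f z = a ^ p • f ((a ^ p)⁻¹ • stretch a p z) := by
  have hb : 0 < a ^ p := Real.rpow_pos_of_pos ha0 p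
  rcases le_total ‖z‖ a with h | h
  · rw [hf.block_of_norm_le ha0 ha1 h, stretch_of_le ha1 h, smul_smul, Real.rpow_sub_one ha0.ne']
    congr 3
    field_simp
  · rw [hf.block_of_le ha0 h, hf.smul_of_le hb (rpow_le_norm_stretch ha0 ha1 hp h)]

lemma IsDiscMap.block (hf : IsDiscMap f) (ha0 : 0 < a) (ha1 : a ≤ 1) (hp : 0 < p) :
    IsDiscMap (block a p f) where
  eq_self z hz := by rw [hf.block_of_le ha0 (ha1.trans hz), stretch_of_one_le ha1 hz]
  norm_le z hz := by
    rcases le_total ‖z‖ a with h | h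
    · exact norm_stretch_le_one ha0 ha1 hp ((hf.norm_smul_le ha0 h).trans ha1)
    · rw [hf.block_of_le ha0 h]
      exact norm_stretch_le_one ha0 ha1 hp hz
  lipschitz := by
    obtain ⟨C, hC0, hC⟩ := exists_norm_stretch_sub_le ha0 p
    obtain ⟨D, hD0, hD⟩ := hf.lipschitz
    refine ⟨C * D, by positivity, fun z w => (hC _ _).trans ?_⟩
    rw [mul_assoc]
    refine mul_le_mul_of_nonneg_left ?_ hC0
    rw [← smul_sub, norm_smul, Real.norm_of_nonneg ha0.le]
    calc a * ‖f (a⁻¹ • z) - f (a⁻¹ • w)‖ ≤ a * (D * ‖a⁻¹ • z - a⁻¹ • w‖) := by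
          gcongr
          exact hD _ _
      _ = D * ‖z - w‖ := by
          rw [← smul_sub, norm_smul, norm_inv, Real.norm_of_nonneg ha0.le]
          field_simp

lemma block_inv_block (hf : IsDiscMap f) (hgf : ∀ z, g (f z) = z) (ha0 : 0 < a) (ha1 : a ≤ 1)
    (hp : 0 < p) (z : ℂ) : block (a ^ p) p⁻¹ g (block a p f z) = z := by
  have hb : 0 < a ^ p := Real.rpow_pos_of_pos ha0 p
  rw [hf.block_eq_comp_stretch ha0 ha1 hp, block, inv_smul_smul₀ hb.ne', hgf,
    smul_inv_smul₀ hb.ne', stretch_inv_stretch ha0 ha1 hp]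

lemma norm_block_sub_block_le (hf : IsDiscMap f) (hg : IsDiscMap g) (ha0 : 0 < a) (ha1 : a ≤ 1)
    {M : ℝ} (hM : ∀ z, ‖f z - g z‖ ≤ M) (z : ℂ) :
    ‖block a p f z - block a p g z‖ ≤ a ^ p * M := by
  rcases le_total ‖z‖ a with h | h
  · rw [hf.block_of_norm_le ha0 ha1 h, hg.block_of_norm_le ha0 ha1 h, ← smul_sub, norm_smul,
      Real.norm_of_nonneg (by positivity)]
    gcongr
    exact hM _
  · rw [hf.block_of_le ha0 h, hg.block_of_le ha0 h, sub_self, norm_zero]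
    have := (norm_nonneg _).trans (hM z)
    positivity

end Stretch

/-! ### One generation of the construction -/

namespace DiskPacking

/-- The map that acts on each disc of a packing by a rescaled block. -/
noncomputable def step (P : DiskPacking) (α p : ℝ) (f : ℂ → ℂ) (z : ℂ) : ℂ :=
  z + ∑ i, P.radius i • (block (P.radius i ^ α) p f ((P.radius i)⁻¹ • (z - P.center i)) -
    (P.radius i)⁻¹ • (z - P.center i))

variable {P : DiskPacking} {α p : ℝ} {f g : ℂ → ℂ}

lemma rpow_radius_pos (i : Fin P.card) : 0 < P.radius i ^ α :=
  Real.rpow_pos_of_pos (P.radius_pos i) _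

lemma Fine.rpow_radius_le_one (h : P.Fine α) (i : Fin P.card) : P.radius i ^ α ≤ 1 :=
  (h i).trans (by norm_num)

lemma Fine.isDiscMap_block (h : P.Fine α) (hp : 0 < p) (hf : IsDiscMap f) (i : Fin P.card) :
    IsDiscMap (block (P.radius i ^ α) p f) :=
  hf.block (rpow_radius_pos i) (h.rpow_radius_le_one i) hp

lemma radius_le_norm_sub_of_mem {i j : Fin P.card} {z : ℂ} (hij : i ≠ j)
    (hz : ‖z - P.center i‖ ≤ P.radius i) : P.radius j ≤ ‖z - P.center j‖ := by
  have h1 := P.radius_add_radius_le i j hij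
  have h2 := dist_triangle_left (P.center i) (P.center j) z
  rw [dist_eq_norm z, dist_eq_norm z] at h2
  linarith

lemma norm_le_one_of_mem {i : Fin P.card} {z : ℂ} (hz : ‖z - P.center i‖ ≤ P.radius i) :
    ‖z‖ ≤ 1 := by
  have h1 := P.norm_center_add_radius_le i
  have h2 := norm_le_norm_sub_add z (P.center i)
  linarith

lemma step_eq_of_forall_ne (h : P.Fine α) (hp : 0 < p) (hf : IsDiscMap f) {i : Fin P.card} {z : ℂ}
    (hz : ∀ j ≠ i, P.radius j ≤ ‖z - P.center j‖) :
    P.step α p f z = P.center i +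
      P.radius i • block (P.radius i ^ α) p f ((P.radius i)⁻¹ • (z - P.center i)) := by
  rw [step, Finset.sum_eq_single i, smul_sub, smul_inv_smul₀ (P.radius_pos i).ne']
  · abel
  · intro j _ hj
    rw [(h.isDiscMap_block hp hf j).eq_self _ ((one_le_norm_inv_smul (P.radius_pos j)).2 (hz j hj)),
      sub_self, smul_zero]
  · simp

lemma step_of_mem (h : P.Fine α) (hp : 0 < p) (hf : IsDiscMap f) {i : Fin P.card} {z : ℂ}
    (hz : ‖z - P.center i‖ ≤ P.radius i) :
    P.step α p f z = P.center i +
      P.radius i • block (P.radius i ^ α) p f ((P.radius i)⁻¹ • (z - P.center i)) :=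
  step_eq_of_forall_ne h hp hf fun _ hj => radius_le_norm_sub_of_mem hj.symm hz

lemma step_of_forall (h : P.Fine α) (hp : 0 < p) (hf : IsDiscMap f) {z : ℂ}
    (hz : ∀ j, P.radius j ≤ ‖z - P.center j‖) : P.step α p f z = z := by
  rw [step, Finset.sum_eq_zero, add_zero]
  intro j _
  rw [(h.isDiscMap_block hp hf j).eq_self _ ((one_le_norm_inv_smul (P.radius_pos j)).2 (hz j)),
    sub_self, smul_zero]

lemma norm_step_sub_center_le (h : P.Fine α) (hp : 0 < p) (hf : IsDiscMap f) {i : Fin P.card}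
    {z : ℂ} (hz : ‖z - P.center i‖ ≤ P.radius i) :
    ‖P.step α p f z - P.center i‖ ≤ P.radius i := by
  have h0 := P.radius_pos i
  rw [step_of_mem h hp hf hz, add_sub_cancel_left, norm_smul, Real.norm_of_nonneg h0.le]
  exact mul_le_of_le_one_right h0.le
    ((h.isDiscMap_block hp hf i).norm_le _ ((norm_inv_smul_le_one h0).2 hz))

lemma mem_or_forall (z : ℂ) : (∃ i, ‖z - P.center i‖ ≤ P.radius i) ∨
    ∀ i, P.radius i ≤ ‖z - P.center i‖ := by
  by_cases hz : ∃ i, ‖z - P.center i‖ ≤ P.radius i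
  · exact Or.inl hz
  · push Not at hz
    exact Or.inr fun i => (hz i).le

lemma isDiscMap_step (h : P.Fine α) (hp : 0 < p) (hf : IsDiscMap f) :
    IsDiscMap (P.step α p f) where
  eq_self z hz := step_of_forall h hp hf fun j => by
    have h1 := P.norm_center_add_radius_le j
    have h2 := norm_le_norm_sub_add z (P.center j)
    linarith
  norm_le z hz := by
    rcases mem_or_forall (P := P) z with ⟨i, hi⟩ | hi
    · exact norm_le_one_of_mem (norm_step_sub_center_le h hp hf hi)
    · rwa [step_of_forall h hp hf hi]
  lipschitz := by
    choose C hC0 hC using fun i => (h.isDiscMap_block hp hf i).lipschitz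
    refine ⟨1 + ∑ i, (C i + 1), add_nonneg zero_le_one (Finset.sum_nonneg fun i _ =>
      add_nonneg (hC0 i) zero_le_one), fun z w => ?_⟩
    have hsplit : P.step α p f z - P.step α p f w = (z - w) + ∑ i, P.radius i •
        ((block (P.radius i ^ α) p f ((P.radius i)⁻¹ • (z - P.center i)) -
          block (P.radius i ^ α) p f ((P.radius i)⁻¹ • (w - P.center i))) -
          (P.radius i)⁻¹ • (z - w)) := by
      rw [step, step, add_sub_add_comm, ← Finset.sum_sub_distrib]
      congr 1
      refine Finset.sum_congr rfl fun i _ => ?_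
      module
    rw [hsplit, add_mul, one_mul, Finset.sum_mul]
    refine (norm_add_le _ _).trans (add_le_add le_rfl (norm_sum_le_of_le _ fun i _ => ?_))
    have h0 := P.radius_pos i
    rw [norm_smul, Real.norm_of_nonneg h0.le]
    have h1 := hC i ((P.radius i)⁻¹ • (z - P.center i)) ((P.radius i)⁻¹ • (w - P.center i))
    have h2 : (P.radius i)⁻¹ • (z - P.center i) - (P.radius i)⁻¹ • (w - P.center i) =
      (P.radius i)⁻¹ • (z - w) := by module
    rw [h2] at h1
    calc _ ≤ P.radius i * (C i * ‖(P.radius i)⁻¹ • (z - w)‖ + ‖(P.radius i)⁻¹ • (z - w)‖) := by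
          gcongr
          exact (norm_sub_le _ _).trans (add_le_add_left h1 _)
      _ = (C i + 1) * ‖z - w‖ := by
          rw [norm_smul, norm_inv, Real.norm_of_nonneg h0.le]
          field_simp

lemma rpow_rpow_radius (i : Fin P.card) : (P.radius i ^ α) ^ p = P.radius i ^ (α * p) :=
  (Real.rpow_mul (P.radius_pos i).le _ _).symm

lemma step_inv_step (h : P.Fine α) (h' : P.Fine (α * p)) (hp : 0 < p) (hf : IsDiscMap f)
    (hg : IsDiscMap g) (hgf : ∀ z, g (f z) = z) (z : ℂ) :
    P.step (α * p) p⁻¹ g (P.step α p f z) = z := by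
  rcases mem_or_forall (P := P) z with ⟨i, hi⟩ | hi
  · have h0 := P.radius_pos i
    rw [step_of_mem h' (inv_pos.2 hp) hg (norm_step_sub_center_le h hp hf hi),
      step_of_mem h hp hf hi, add_sub_cancel_left, inv_smul_smul₀ h0.ne', ← rpow_rpow_radius,
      block_inv_block hf hgf (rpow_radius_pos i) (h.rpow_radius_le_one i) hp,
      smul_inv_smul₀ h0.ne', add_sub_cancel]
  · rw [step_of_forall h hp hf hi, step_of_forall h' (inv_pos.2 hp) hg hi]

/-- The inserted maps matter only on the smaller discs, whose images have radius at most `1 / 2` by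
fineness at `α * p`. Hence `step` is a contraction in its argument. -/
lemma norm_step_sub_step_le (h : P.Fine α) (h' : P.Fine (α * p)) (hp : 0 < p) (hf : IsDiscMap f)
    (hg : IsDiscMap g) {M : ℝ} (hM : ∀ z, ‖f z - g z‖ ≤ M) (z : ℂ) :
    ‖P.step α p f z - P.step α p g z‖ ≤ M / 2 := by
  have hM0 := (norm_nonneg _).trans (hM z)
  rcases mem_or_forall (P := P) z with ⟨i, hi⟩ | hi
  · have h0 := P.radius_pos i
    rw [step_of_mem h hp hf hi, step_of_mem h hp hg hi, add_sub_add_left_eq_sub, ← smul_sub,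
      norm_smul, Real.norm_of_nonneg h0.le]
    have h1 := norm_block_sub_block_le (p := p) hf hg (rpow_radius_pos i)
      (h.rpow_radius_le_one i) hM ((P.radius i)⁻¹ • (z - P.center i))
    rw [rpow_rpow_radius] at h1
    calc _ ≤ 1 * (1 / 2 * M) := by
          refine mul_le_mul (P.radius_le_one i) (h1.trans ?_) (norm_nonneg _) zero_le_one
          exact mul_le_mul_of_nonneg_right (h' i) hM0
      _ = M / 2 := by ring
  · rw [step_of_forall h hp hf hi, step_of_forall h hp hg hi, sub_self, norm_zero]
    positivity

lemma inv_ratio_smul (i : Fin P.card) (z : ℂ) :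
    (P.radius i ^ α)⁻¹ • (P.radius i)⁻¹ • z = (P.ratio α i)⁻¹ • z := by
  rw [smul_smul, ratio, mul_inv_rev]

lemma step_congr {z : ℂ} (hfg : ∀ i, f ((P.ratio α i)⁻¹ • (z - P.center i)) =
    g ((P.ratio α i)⁻¹ • (z - P.center i))) : P.step α p f z = P.step α p g z := by
  simp only [step, block, inv_ratio_smul, hfg]

/-- On smaller discs `step` intertwines the similarities of the two Cantor sets; this is how codes
are preserved. -/
lemma step_center_add (h : P.Fine α) (hp : 0 < p) (hf : IsDiscMap f) (i : Fin P.card)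
    {z : ℂ} (hz : ‖z‖ ≤ 1) :
    P.step α p f (P.center i + P.ratio α i • z) = P.center i + P.ratio (α * p) i • f z := by
  have h0 := P.radius_pos i
  have ha := rpow_radius_pos (α := α) i
  have hr : ‖P.ratio α i • z‖ ≤ P.radius i := by
    rw [norm_smul, Real.norm_of_nonneg (ratio_pos i).le]
    have := h.ratio_le i
    have := mul_le_of_le_one_right (ratio_pos (α := α) i).le hz
    linarith
  rw [step_of_mem h hp hf (i := i) (by simpa using hr), add_sub_cancel_left, ratio, mul_smul,
    inv_smul_smul₀ h0.ne', hf.block_of_norm_le ha (h.rpow_radius_le_one i), inv_smul_smul₀ ha.ne',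
    rpow_rpow_radius, ratio, mul_smul]
  rw [norm_smul, Real.norm_of_nonneg ha.le]
  exact mul_le_of_le_one_right ha.le hz

end DiskPacking

/-! ### Approximations and the limit homeomorphism -/

lemma IsDiscMap.continuous {f : ℂ → ℂ} (hf : IsDiscMap f) : Continuous f := by
  obtain ⟨C, -, hC⟩ := hf.lipschitz
  exact (LipschitzWith.of_dist_le' (K := C) fun z w => by
    simpa only [dist_eq_norm] using hC z w).continuous

lemma tendstoUniformly_of_norm_sub_le {f : ℕ → ℂ → ℂ} {F : ℂ → ℂ}
    (h : ∀ m z, ‖f m z - F z‖ ≤ 4 * (1 / 2) ^ m) : TendstoUniformly f F atTop := by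
  rw [Metric.tendstoUniformly_iff]
  intro ε hε
  have hlim : Tendsto (fun m : ℕ => 4 * (1 / 2 : ℝ) ^ m) atTop (𝓝 0) := by
    simpa using (tendsto_pow_atTop_nhds_zero_of_lt_one (r := (1 / 2 : ℝ)) (by norm_num)
      (by norm_num)).const_mul 4
  filter_upwards [hlim.eventually (gt_mem_nhds hε)] with m hm z
  rw [dist_comm, dist_eq_norm]
  exact (h m z).trans_lt hm

lemma leftInverse_of_tendstoUniformly {f g : ℕ → ℂ → ℂ} {F G : ℂ → ℂ}
    (hf : TendstoUniformly f F atTop) (hg : TendstoUniformly g G atTop)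
    (hgc : ∀ m, Continuous (g m)) (h : ∀ m z, g m (f m z) = z) (z : ℂ) : G (F z) = z := by
  have hG : Continuous G := hg.continuous (Frequently.of_forall hgc)
  have h1 : Tendsto (fun m => g m (f m z)) atTop (𝓝 (G (F z))) :=
    hg.tendstoLocallyUniformly.tendsto_comp hG.continuousAt (hf.tendsto_at z)
  simp only [h] at h1
  exact (tendsto_nhds_unique h1 tendsto_const_nhds)

section Approx

variable {α p : ℝ}

/-- The `m`-th approximation to the map carrying the Cantor set with parameter `α` to the one with
parameter `α * p`. -/
noncomputable def approx (α p : ℝ) : ℕ → (ℕ → DiskPacking) → ℂ → ℂ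
  | 0, _ => id
  | m + 1, P => (P 0).step α p (approx α p m fun j => P (j + 1))

/-- The union of the discs of the `m`-th generation of the Cantor set. -/
noncomputable def cylinders (α : ℝ) : ℕ → (ℕ → DiskPacking) → Set ℂ
  | 0, _ => closedBall 0 1
  | m + 1, P => ⋃ i, (fun z => (P 0).center i + (P 0).ratio α i • z) ''
      cylinders α m fun j => P (j + 1)

lemma isCompact_cylinders (m : ℕ) (P : ℕ → DiskPacking) : IsCompact (cylinders α m P) := by
  induction m generalizing P with
  | zero => exact isCompact_closedBall 0 1
  | succ m ih => exact isCompact_iUnion fun i => (ih _).image (by fun_prop)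

-- Each generation shrinks area by a factor of at least `4`, because ratios are at most half the
-- radii and the squared radii sum to at most `1`.
open scoped Pointwise in
lemma volume_cylinders_le (m : ℕ) (P : ℕ → DiskPacking) (hP : ∀ n, (P n).Fine α) :
    volume (cylinders α m P) ≤ ENNReal.ofReal ((1 / 4) ^ m) * volume (closedBall (0 : ℂ) 1) := by
  induction m generalizing P with
  | zero => simp [cylinders]
  | succ m ih =>
    set V := volume (closedBall (0 : ℂ) 1)
    have him : ∀ i, volume ((fun z => (P 0).center i + (P 0).ratio α i • z) ''
        cylinders α m fun j => P (j + 1)) ≤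
        ENNReal.ofReal ((P 0).ratio α i ^ 2) * (ENNReal.ofReal ((1 / 4) ^ m) * V) := fun i => by
      have h1 : (fun z => (P 0).center i + (P 0).ratio α i • z) ''
          (cylinders α m fun j => P (j + 1)) = (fun z => (P 0).center i + z) ''
          ((P 0).ratio α i • cylinders α m fun j => P (j + 1)) := by
        rw [← image_smul, image_image]
      rw [h1, image_add_left, measure_preimage_add, Measure.addHaar_smul, Complex.finrank_real_complex,
        abs_of_nonneg (sq_nonneg _)]
      gcongr
      exact ih _ fun n => hP (n + 1)
    calc volume (cylinders α (m + 1) P)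
        ≤ ∑ i, ENNReal.ofReal ((P 0).ratio α i ^ 2) * (ENNReal.ofReal ((1 / 4) ^ m) * V) :=
          (measure_iUnion_fintype_le _ _).trans (Finset.sum_le_sum fun i _ => him i)
      _ = ENNReal.ofReal (∑ i, (P 0).ratio α i ^ 2) * (ENNReal.ofReal ((1 / 4) ^ m) * V) := by
          rw [← Finset.sum_mul, ENNReal.ofReal_sum_of_nonneg fun _ _ => sq_nonneg _]
      _ ≤ ENNReal.ofReal (1 / 4) * (ENNReal.ofReal ((1 / 4) ^ m) * V) := by
          gcongr
          calc ∑ i, (P 0).ratio α i ^ 2 ≤ ∑ i, (P 0).radius i ^ 2 / 4 :=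
                Finset.sum_le_sum fun i _ => by
                  have h1 := (hP 0).ratio_le i
                  have h2 := DiskPacking.ratio_pos (α := α) i
                  nlinarith
            _ ≤ 1 / 4 := by
                rw [← Finset.sum_div]
                have := (P 0).mass_le_one
                rw [DiskPacking.mass] at this
                linarith
      _ = _ := by rw [← mul_assoc, ← ENNReal.ofReal_mul (by norm_num), ← pow_succ']

variable {P : ℕ → DiskPacking} (hP : ∀ n, (P n).Fine α) (hp : 0 < p)
include hP hp

lemma isDiscMap_approx (m : ℕ) : IsDiscMap (approx α p m P) := by
  induction m generalizing P with
  | zero => exact IsDiscMap.id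
  | succ m ih => exact DiskPacking.isDiscMap_step (hP 0) hp (ih fun n => hP (n + 1))

/-- Later generations modify the map only inside the cylinders. This later gives local equality of
the limit with an approximation, hence equal derivatives. -/
lemma approx_add_eq (m k : ℕ) {z : ℂ} (hz : z ∉ cylinders α m P) :
    approx α p (m + k) P z = approx α p m P z := by
  induction m generalizing P z with
  | zero =>
    simp only [cylinders, mem_closedBall_zero_iff, not_le] at hz
    rw [(isDiscMap_approx hP hp _).eq_self z hz.le, (isDiscMap_approx hP hp _).eq_self z hz.le]
  | succ m ih =>
    rw [Nat.succ_add]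
    refine DiskPacking.step_congr fun i => ih (fun n => hP (n + 1)) fun h => hz ?_
    refine mem_iUnion.2 ⟨i, _, h, ?_⟩
    simp only
    rw [smul_inv_smul₀ (DiskPacking.ratio_pos i).ne', add_sub_cancel]

variable (hP' : ∀ n, (P n).Fine (α * p))
include hP'

lemma norm_approx_succ_sub_le (m : ℕ) (z : ℂ) :
    ‖approx α p m P z - approx α p (m + 1) P z‖ ≤ 2 * (1 / 2) ^ m := by
  induction m generalizing P z with
  | zero =>
    have h0 := isDiscMap_approx hP hp 0
    have h1 := isDiscMap_approx hP hp 1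
    rcases le_total ‖z‖ 1 with h | h
    · refine (norm_sub_le _ _).trans ?_
      have := h0.norm_le z h
      have := h1.norm_le z h
      norm_num
      linarith
    · rw [h0.eq_self z h, h1.eq_self z h]
      simp
  | succ m ih =>
    have hP1 : ∀ n, (P (n + 1)).Fine α := fun n => hP (n + 1)
    refine (DiskPacking.norm_step_sub_step_le (hP 0) (hP' 0) hp (isDiscMap_approx hP1 hp m)
      (isDiscMap_approx hP1 hp (m + 1)) (ih hP1 fun n => hP' (n + 1)) z).trans_eq ?_
    ring

lemma exists_limit : ∃ F : ℂ → ℂ, ∀ m z, ‖approx α p m P z - F z‖ ≤ 4 * (1 / 2) ^ m := by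
  have hle : ∀ z m, dist (approx α p m P z) (approx α p (m + 1) P z) ≤ 4 / 2 / 2 ^ m := by
    intro z m
    rw [dist_eq_norm]
    refine (norm_approx_succ_sub_le hP hp hP' m z).trans_eq ?_
    rw [one_div, inv_pow, div_eq_mul_inv]
    norm_num
  choose F hF using fun z => cauchySeq_tendsto_of_complete (cauchySeq_of_le_geometric_two (hle z))
  refine ⟨F, fun m z => ?_⟩
  have := dist_le_of_le_geometric_two_of_tendsto (hle z) (hF z) m
  rw [dist_eq_norm] at this
  refine this.trans_eq ?_
  rw [one_div, inv_pow, div_eq_mul_inv]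

lemma approx_inv_approx (m : ℕ) (z : ℂ) :
    approx (α * p) p⁻¹ m P (approx α p m P z) = z := by
  induction m generalizing P z with
  | zero => rfl
  | succ m ih =>
    have hP1 : ∀ n, (P (n + 1)).Fine α := fun n => hP (n + 1)
    have hP1' : ∀ n, (P (n + 1)).Fine (α * p) := fun n => hP' (n + 1)
    exact DiskPacking.step_inv_step (hP 0) (hP' 0) hp (isDiscMap_approx hP1 hp m)
      (isDiscMap_approx hP1' (inv_pos.2 hp) m) (ih hP1 hP1') z

lemma norm_approx_codePoint_sub_le (m : ℕ) (w : Code P) :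
    ‖approx α p m P (codePoint α P w) - codePoint (α * p) P w‖ ≤ 2 * (1 / 2) ^ m := by
  induction m generalizing P with
  | zero =>
    refine (norm_sub_le _ _).trans ?_
    have h1 := norm_codePoint_le_one hP w
    have h2 := norm_codePoint_le_one hP' w
    simp only [approx, id]
    norm_num
    linarith
  | succ m ih =>
    have hP1 : ∀ n, (P (n + 1)).Fine α := fun n => hP (n + 1)
    have hP1' : ∀ n, (P (n + 1)).Fine (α * p) := fun n => hP' (n + 1)
    rw [codePoint_eq_head hP, codePoint_eq_head hP', approx, ← Complex.real_smul,
      DiskPacking.step_center_add (hP 0) hp (isDiscMap_approx hP1 hp m) _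
        (norm_codePoint_le_one hP1 _), ← Complex.real_smul, add_sub_add_left_eq_sub, ← smul_sub,
      norm_smul, Real.norm_of_nonneg (DiskPacking.ratio_pos _).le]
    calc _ ≤ 1 / 2 * (2 * (1 / 2) ^ m) :=
          mul_le_mul ((hP' 0).ratio_le_half _) (ih hP1 hP1' _) (norm_nonneg _) (by norm_num)
      _ = _ := by ring

/-- The approximations converge to a homeomorphism of the plane, supported in the unit disc, that
carries one Cantor set to the other. -/
theorem exists_isHomeomorph_limit : ∃ F : ℂ → ℂ,
    (∀ m z, ‖approx α p m P z - F z‖ ≤ 4 * (1 / 2) ^ m) ∧ IsHomeomorph F ∧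
    (∀ z, 1 ≤ ‖z‖ → F z = z) ∧ (∀ m, ∀ z ∉ cylinders α m P, F z = approx α p m P z) ∧
    F '' range (codePoint α P) = range (codePoint (α * p) P) := by
  have hα : α * p * p⁻¹ = α := mul_inv_cancel_right₀ hp.ne' α
  obtain ⟨F, hF⟩ := exists_limit hP hp hP'
  obtain ⟨G, hG⟩ := exists_limit hP' (inv_pos.2 hp) (by rwa [hα])
  have hFu := tendstoUniformly_of_norm_sub_le hF
  have hGu := tendstoUniformly_of_norm_sub_le hG
  have hfc : ∀ m, Continuous (approx α p m P) := fun m => (isDiscMap_approx hP hp m).continuous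
  have hgc : ∀ m, Continuous (approx (α * p) p⁻¹ m P) := fun m =>
    (isDiscMap_approx hP' (inv_pos.2 hp) m).continuous
  have hGF : ∀ z, G (F z) = z := leftInverse_of_tendstoUniformly hFu hGu hgc
    (approx_inv_approx hP hp hP')
  -- The roles of the parameters `α` and `α * p` are exchanged, using `α * p * p⁻¹ = α`.
  have hFG : ∀ z, F (G z) = z := leftInverse_of_tendstoUniformly hGu hFu hfc fun m z => by
    have := approx_inv_approx hP' (inv_pos.2 hp) (by rwa [hα]) m z
    rwa [hα, inv_inv] at this
  let e : ℂ ≃ₜ ℂ := ⟨⟨F, G, hGF, hFG⟩, hFu.continuous (Frequently.of_forall hfc),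
    hGu.continuous (Frequently.of_forall hgc)⟩
  refine ⟨F, hF, e.isHomeomorph, fun z hz => ?_, fun m z hz => ?_, ?_⟩
  · refine tendsto_nhds_unique (hFu.tendsto_at z) (tendsto_const_nhds.congr fun m => ?_)
    exact ((isDiscMap_approx hP hp m).eq_self z hz).symm
  · refine tendsto_nhds_unique ((hFu.tendsto_at z).comp (tendsto_add_atTop_nat m))
      (tendsto_const_nhds.congr fun k => ?_)
    simp only [Function.comp_apply]
    rw [add_comm, approx_add_eq hP hp m k hz]
  · rw [← range_comp]
    congr 1
    ext1 w
    refine tendsto_nhds_unique (hFu.tendsto_at (codePoint α P w)) ?_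
    rw [tendsto_iff_norm_sub_tendsto_zero]
    refine squeeze_zero (fun _ => norm_nonneg _)
      (fun m => norm_approx_codePoint_sub_le hP hp hP' m w) ?_
    simpa using (tendsto_pow_atTop_nhds_zero_of_lt_one (r := (1 / 2 : ℝ)) (by norm_num)
      (by norm_num)).const_mul 2

end Approx

/-! ### Orientation -/

lemma eq_of_exp_eq {A : Type*} [TopologicalSpace A] [PreconnectedSpace A] {g₁ g₂ : A → ℂ}
    (h₁ : Continuous g₁) (h₂ : Continuous g₂) (h : ∀ x, Complex.exp (g₁ x) = Complex.exp (g₂ x))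
    (a : A) (ha : g₁ a = g₂ a) : g₁ = g₂ :=
  Complex.isCoveringMap_exp.eq_of_comp_eq h₁ h₂ (funext fun x => Subtype.ext (h x)) a ha

lemma exists_continuous_log {u : ℂ → ℂ} (hu : Continuous u) (h0 : ∀ w, u w ≠ 0) :
    ∃ L : ℂ → ℂ, Continuous L ∧ ∀ w, Complex.exp (L w) = u w := by
  obtain ⟨L, ⟨-, hL⟩, -⟩ := Complex.isCoveringMap_exp.existsUnique_continuousMap_lifts
    (⟨fun w => ⟨u w, h0 w⟩, by fun_prop⟩ : C(ℂ, {z : ℂ // z ≠ 0})) 0 (Complex.log (u 0))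
    (Subtype.ext (Complex.exp_log (h0 0)))
  exact ⟨L, L.continuous, fun w => congrArg Subtype.val (congrFun hL w)⟩

/-- A homeomorphism of the plane that is the identity outside the unit disc preserves
orientation. -/
theorem isOrientationPreserving_of_eq_self {F : ℂ → ℂ} (hF : IsHomeomorph F)
    (hF1 : ∀ z, 1 ≤ ‖z‖ → F z = z) : IsOrientationPreserving F := by
  intro c r hr
  obtain ⟨L, hLc, hL⟩ := exists_continuous_log (u := fun w => F (c + Complex.exp w) - F c)
    ((hF.continuous.comp (by fun_prop)).sub continuous_const) fun w h => by
      have := hF.injective (sub_eq_zero.1 h)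
      simp at this
  have hper : ∀ w : ℂ, Complex.exp (w + 2 * Real.pi * Complex.I) = Complex.exp w := by
    intro w
    rw [Complex.exp_add, Complex.exp_two_pi_mul_I, mul_one]
  -- The increment of the logarithm over one turn. It takes values in the periods of `exp` and is
  -- continuous, so it is independent of the circle and can be computed on a large one.
  set k : ℂ → ℂ := fun w => L (w + 2 * Real.pi * Complex.I) - L w
  have hk : ∀ w w', k w = k w' := by
    intro w w'
    refine congrFun (eq_of_exp_eq (g₁ := k) (g₂ := fun _ => k w') (by fun_prop) continuous_const
      (fun x => ?_) w' rfl) w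
    have : ∀ x, Complex.exp (k x) = 1 := fun x => by
      simp only [k]
      rw [Complex.exp_sub, hL, hper, ← hL, div_self (Complex.exp_ne_zero _)]
    rw [this, this]
  -- On this circle `F` is the identity and the increment from `F c` is `exp w` times `q`. The
  -- perturbation in `q` has norm below `1`, so the principal logarithm of `q` is continuous and
  -- contributes no winding.
  obtain ⟨ρ, hρ⟩ : ∃ ρ : ℝ, 1 + ‖c‖ + 2 * ‖c - F c‖ ≤ Real.exp ρ :=
    (Real.tendsto_exp_atTop.eventually_ge_atTop _).exists
  have hnorm : ∀ θ : ℝ, ‖Complex.exp (ρ + θ * Complex.I)‖ = Real.exp ρ := by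
    intro θ
    rw [Complex.norm_exp]
    simp
  set q : ℝ → ℂ := fun θ => 1 + (c - F c) * Complex.exp (-(ρ + θ * Complex.I))
  have hq : ∀ θ, q θ ∈ Complex.slitPlane := by
    intro θ
    refine Complex.mem_slitPlane_of_norm_lt_one (z := _) ?_
    rw [norm_mul, Complex.exp_neg, norm_inv, hnorm, ← div_eq_mul_inv, div_lt_one (Real.exp_pos _)]
    linarith [norm_nonneg c, norm_nonneg (c - F c)]
  have hexp : ∀ θ : ℝ, Complex.exp (L (ρ + θ * Complex.I)) =
      Complex.exp (ρ + θ * Complex.I) * q θ := by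
    intro θ
    have h1 : 1 ≤ ‖c + Complex.exp (ρ + θ * Complex.I)‖ := by
      have := norm_sub_le_norm_add (Complex.exp (ρ + θ * Complex.I)) c
      rw [hnorm, add_comm] at this
      linarith [norm_nonneg (c - F c)]
    rw [hL, hF1 _ h1, mul_add, mul_left_comm, ← Complex.exp_add, add_neg_cancel, Complex.exp_zero]
    ring
  set g : ℝ → ℂ := fun θ => ρ + θ * Complex.I + Complex.log (q θ) + (L ρ - ρ - Complex.log (q 0))
  have hgc : Continuous g := by
    have : Continuous fun θ => Complex.log (q θ) :=
      Continuous.clog (by fun_prop) hq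
    fun_prop
  have hgL : (fun θ : ℝ => L (ρ + θ * Complex.I)) = g := by
    refine eq_of_exp_eq (by fun_prop) hgc (fun θ => ?_) 0 (by simp [g])
    have h0 := hexp 0
    have hq0 := Complex.slitPlane_ne_zero (hq 0)
    simp only [Complex.ofReal_zero, zero_mul, add_zero] at h0
    simp only [g]
    rw [hexp, Complex.exp_add _ (_ - _), Complex.exp_add _ (Complex.log _),
      Complex.exp_log (Complex.slitPlane_ne_zero (hq θ)), Complex.exp_sub, Complex.exp_sub, h0,
      Complex.exp_log hq0, mul_div_cancel_left₀ _ (Complex.exp_ne_zero _), div_self hq0, mul_one]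
  have hkρ : k ρ = 2 * Real.pi * Complex.I := by
    have h2π := congrFun hgL (2 * Real.pi)
    have h0 := congrFun hgL 0
    have hq2 : q (2 * Real.pi) = q 0 := by
      simp only [q]
      push_cast
      rw [neg_add, ← hper (-(ρ : ℂ) + _)]
      simp
    simp only [g, hq2] at h2π h0
    push_cast at h2π h0
    simp only [zero_mul, add_zero] at h0
    simp only [k]
    rw [h2π]
    ring
  refine ⟨fun θ => L (Real.log r + θ * Complex.I), by fun_prop, fun θ => ?_, ?_⟩
  · rw [hL, Complex.exp_add, ← Complex.ofReal_exp, Real.exp_log hr, circleMap]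
  · rw [← hkρ, hk ρ (Real.log r)]
    simp [k]

/-! ### Pointwise distortion -/

/-- A real-linear map of the plane whose stretching factors differ by a factor of at most `K`. -/
def HasDistortion (K : ℝ) (A : ℂ →L[ℝ] ℂ) : Prop :=
  ∃ l : ℝ, 0 ≤ l ∧ ∀ v, l * ‖v‖ ≤ ‖A v‖ ∧ ‖A v‖ ≤ K * l * ‖v‖

/-- `f` is differentiable at `z`, with derivative of distortion at most `K`. -/
def HasDistortionAt (K : ℝ) (f : ℂ → ℂ) (z : ℂ) : Prop :=
  ∃ A : ℂ →L[ℝ] ℂ, HasFDerivAt f A z ∧ HasDistortion K A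

section Distortion

variable {K : ℝ} {f g : ℂ → ℂ} {z : ℂ}

lemma HasDistortion.smul {A : ℂ →L[ℝ] ℂ} (h : HasDistortion K A) {r : ℝ} (hr : 0 ≤ r) :
    HasDistortion K (r • A) := by
  obtain ⟨l, hl, h⟩ := h
  refine ⟨r * l, by positivity, fun v => ?_⟩
  rw [smul_apply, norm_smul, Real.norm_of_nonneg hr]
  constructor
  · rw [mul_assoc]
    exact mul_le_mul_of_nonneg_left (h v).1 hr
  · calc r * ‖A v‖ ≤ r * (K * l * ‖v‖) := mul_le_mul_of_nonneg_left (h v).2 hr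
      _ = _ := by ring

lemma HasDistortionAt.congr (h : HasDistortionAt K f z) (hfg : g =ᶠ[𝓝 z] f) :
    HasDistortionAt K g z := by
  obtain ⟨A, hA, hK⟩ := h
  exact ⟨A, hA.congr_of_eventuallyEq hfg, hK⟩

lemma hasDistortionAt_id (hK : 1 ≤ K) (z : ℂ) : HasDistortionAt K id z :=
  ⟨_, hasFDerivAt_id z, 1, zero_le_one, fun v => by
    simpa using le_mul_of_one_le_left (norm_nonneg v) hK⟩

lemma HasDistortionAt.rescale {c d : ℂ} {r s : ℝ} (hr : 0 < r) (hs : 0 < s)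
    (h : HasDistortionAt K f (r⁻¹ • (z - c))) :
    HasDistortionAt K (fun w => d + s • f (r⁻¹ • (w - c))) z := by
  obtain ⟨A, hA, hK⟩ := h
  refine ⟨(s * r⁻¹) • A, ?_, hK.smul (by positivity)⟩
  have h1 : HasFDerivAt (fun w : ℂ => r⁻¹ • (w - c)) (r⁻¹ • ContinuousLinearMap.id ℝ ℂ) z :=
    ((hasFDerivAt_id z).sub_const c).const_smul r⁻¹
  have h2 := ((hA.comp z h1).const_smul s).const_add d
  refine HasFDerivAt.congr_fderiv h2 (ContinuousLinearMap.ext fun v => ?_)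
  simp [mul_assoc]

/-- Up to the scalar `‖z‖ ^ (p - 1)` the derivative stretches by `p` radially and by `1`
tangentially, with `p = K⁻¹`. -/
lemma hasDistortionAt_radial (hK : 1 ≤ K) (hz : z ≠ 0) :
    HasDistortionAt K (fun w => ‖w‖ ^ (K⁻¹ - 1) • w) z := by
  have hK0 : 0 < K := by linarith
  set p := K⁻¹
  have hp0 : 0 < p := inv_pos.2 hK0
  have hp1 : p ≤ 1 := inv_le_one_of_one_le₀ hK
  have hn : 0 < ‖z‖ := norm_pos_iff.2 hz
  have h1 := ((hasStrictFDerivAt_norm_sq z).hasFDerivAt.rpow_const (p := (p - 1) / 2)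
    (Or.inl (by positivity))).smul (hasFDerivAt_id z)
  have h2 : ∀ w : ℂ, (‖w‖ ^ 2) ^ ((p - 1) / 2) = ‖w‖ ^ (p - 1) := fun w => by
    rw [← Real.rpow_two, ← Real.rpow_mul (norm_nonneg w)]
    congr 1
    ring
  simp only [h2] at h1
  have h3 : (‖z‖ ^ 2) ^ ((p - 1) / 2 - 1) = ‖z‖ ^ (p - 1) / ‖z‖ ^ 2 := by
    rw [Real.rpow_sub_one (by positivity), h2]
  let A : ℂ →L[ℝ] ℂ := ‖z‖ ^ (p - 1) •
    (ContinuousLinearMap.id ℝ ℂ + ((p - 1) / ‖z‖ ^ 2) • (innerSL ℝ z).smulRight z)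
  have hA : HasFDerivAt (fun w => ‖w‖ ^ (p - 1) • w) A z := by
    refine HasFDerivAt.congr_fderiv h1 (ContinuousLinearMap.ext fun v => ?_)
    rw [h3]
    simp [A, smul_smul, mul_add]
    ring
  refine ⟨A, hA, ‖z‖ ^ (p - 1) * p, by positivity, fun v => ?_⟩
  set s := inner ℝ z v
  have happ : A v = ‖z‖ ^ (p - 1) • (v + ((p - 1) * (s / ‖z‖ ^ 2)) • z) := by
    simp only [A, add_apply, smul_apply, ContinuousLinearMap.id_apply,
      ContinuousLinearMap.smulRight_apply, innerSL_apply_apply, smul_smul]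
    congr 3
    ring
  have hsq : ‖v + ((p - 1) * (s / ‖z‖ ^ 2)) • z‖ ^ 2 =
      ‖v‖ ^ 2 + (p ^ 2 - 1) * (s ^ 2 / ‖z‖ ^ 2) := by
    rw [norm_add_sq_real, real_inner_smul_right, real_inner_comm, norm_smul, mul_pow,
      Real.norm_eq_abs, sq_abs]
    field_simp
    ring
  have hs0 : 0 ≤ s ^ 2 / ‖z‖ ^ 2 := by positivity
  have hs1 : s ^ 2 / ‖z‖ ^ 2 ≤ ‖v‖ ^ 2 := by
    rw [div_le_iff₀ (by positivity), mul_comm, ← mul_pow]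
    exact sq_le_sq' (by linarith [neg_abs_le s, abs_real_inner_le_norm z v])
      (real_inner_le_norm z v)
  have hp2 : p ^ 2 ≤ 1 := pow_le_one₀ hp0.le hp1
  have hKp : K * (‖z‖ ^ (p - 1) * p) = ‖z‖ ^ (p - 1) := by
    rw [mul_left_comm, mul_inv_cancel₀ hK0.ne', mul_one]
  have hpos : 0 ≤ ‖z‖ ^ (p - 1) := by positivity
  rw [hKp, happ, norm_smul, Real.norm_of_nonneg hpos, mul_assoc]
  refine ⟨mul_le_mul_of_nonneg_left ?_ hpos, mul_le_mul_of_nonneg_left ?_ hpos⟩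
  · refine (sq_le_sq₀ (by positivity) (norm_nonneg _)).1 ?_
    rw [hsq, mul_pow]
    nlinarith
  · refine (sq_le_sq₀ (norm_nonneg _) (norm_nonneg _)).1 ?_
    rw [hsq]
    nlinarith

lemma ae_norm_sub_ne (c : ℂ) (r : ℝ) : ∀ᵐ z : ℂ, ‖z - c‖ ≠ r := by
  have : volume (sphere c r) = 0 := Measure.addHaar_sphere _ _ _
  filter_upwards [compl_mem_ae_iff.2 this] with z hz h
  exact hz (by rwa [mem_sphere, dist_eq_norm])

lemma ae_comp_rescale {Q : ℂ → Prop} (h : ∀ᵐ z, Q z) (c : ℂ) {r : ℝ} (hr : r ≠ 0) :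
    ∀ᵐ z : ℂ, Q (r⁻¹ • (z - c)) :=
  ((Measure.quasiMeasurePreserving_smul volume (inv_ne_zero hr)).comp
    (measurePreserving_sub_right volume c).quasiMeasurePreserving).ae h

lemma ae_hasDistortionAt_block (hK : 1 ≤ K) (hf : IsDiscMap f)
    (hD : ∀ᵐ z, HasDistortionAt K f z) {a : ℝ} (ha0 : 0 < a) (ha1 : a ≤ 1) :
    ∀ᵐ z, HasDistortionAt K (block a K⁻¹ f) z := by
  have hK0 : 0 < K := by linarith
  filter_upwards [ae_comp_rescale hD 0 ha0.ne', ae_norm_sub_ne 0 a, ae_norm_sub_ne 0 1]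
    with z hz hza hz1
  rw [sub_zero] at hza hz1
  rcases lt_or_gt_of_ne hza with h | h
  · refine (hz.rescale (d := 0) ha0 (Real.rpow_pos_of_pos ha0 K⁻¹)).congr ?_
    filter_upwards [continuous_norm.continuousAt.eventually (gt_mem_nhds h)] with w hw
    rw [zero_add, sub_zero, hf.block_of_norm_le ha0 ha1 hw.le]
  rcases lt_or_gt_of_ne hz1 with h1 | h1
  · refine (hasDistortionAt_radial hK (norm_pos_iff.1 (ha0.trans h))).congr ?_
    filter_upwards [continuous_norm.continuousAt.eventually (lt_mem_nhds h),
      continuous_norm.continuousAt.eventually (gt_mem_nhds h1)] with w hw hw1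
    rw [hf.block_of_le ha0 hw.le, stretch_of_mem hw.le hw1.le]
  · refine (hasDistortionAt_id hK z).congr ?_
    filter_upwards [continuous_norm.continuousAt.eventually (lt_mem_nhds h1)] with w hw
    exact (hf.block ha0 ha1 (inv_pos.2 hK0)).eq_self w hw.le

lemma ae_hasDistortionAt_step (hK : 1 ≤ K) (hf : IsDiscMap f)
    (hD : ∀ᵐ z, HasDistortionAt K f z) {P : DiskPacking} {α : ℝ} (hP : P.Fine α) :
    ∀ᵐ z, HasDistortionAt K (P.step α K⁻¹ f) z := by
  have hK0 : 0 < K⁻¹ := inv_pos.2 (by linarith)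
  have h1 : ∀ᵐ z : ℂ, ∀ i, HasDistortionAt K (block (P.radius i ^ α) K⁻¹ f)
      ((P.radius i)⁻¹ • (z - P.center i)) := ae_all_iff.2 fun i =>
    ae_comp_rescale (ae_hasDistortionAt_block hK hf hD (DiskPacking.rpow_radius_pos i)
      (hP.rpow_radius_le_one i)) _ (P.radius_pos i).ne'
  filter_upwards [h1, ae_all_iff.2 fun i => ae_norm_sub_ne (P.center i) (P.radius i)] with z hz hne
  have hcont : ∀ i, ContinuousAt (fun w => ‖w - P.center i‖) z := fun i => by fun_prop
  by_cases h : ∃ i, ‖z - P.center i‖ < P.radius i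
  · obtain ⟨i, hi⟩ := h
    refine ((hz i).rescale (d := P.center i) (P.radius_pos i) (P.radius_pos i)).congr ?_
    filter_upwards [(hcont i).eventually (gt_mem_nhds hi)] with w hw
    exact DiskPacking.step_of_mem hP hK0 hf hw.le
  · push Not at h
    refine (hasDistortionAt_id hK z).congr ?_
    filter_upwards [eventually_all.2 fun i =>
      (hcont i).eventually (lt_mem_nhds ((h i).lt_of_ne (hne i).symm))] with w hw
    exact DiskPacking.step_of_forall hP hK0 hf fun i => (hw i).le

lemma ae_hasDistortionAt_approx (hK : 1 ≤ K) {α : ℝ} (m : ℕ) {P : ℕ → DiskPacking}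
    (hP : ∀ n, (P n).Fine α) : ∀ᵐ z, HasDistortionAt K (approx α K⁻¹ m P) z := by
  induction m generalizing P with
  | zero => exact .of_forall fun z => hasDistortionAt_id hK z
  | succ m ih =>
    have hP1 : ∀ n, (P (n + 1)).Fine α := fun n => hP (n + 1)
    exact ae_hasDistortionAt_step hK (isDiscMap_approx hP1 (inv_pos.2 (by linarith)) m) (ih hP1)
      (hP 0)

/-- The image of the unit disc contains the disc of radius `l`, so `l ^ 2 ≤ |A.det|`, while the norm
is at most `K * l`. -/
lemma HasDistortion.sq_norm_le {A : ℂ →L[ℝ] ℂ} (hK : 0 ≤ K) (h : HasDistortion K A) :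
    ‖A‖ ^ 2 ≤ K ^ 2 * |A.det| := by
  obtain ⟨l, hl, h⟩ := h
  have h1 : ‖A‖ ≤ K * l := A.opNorm_le_bound (by positivity) fun v => (h v).2
  have h2 : l ^ 2 ≤ |A.det| := by
    rcases hl.eq_or_lt with rfl | hl0
    · simp
    have hinj : Function.Injective (A : ℂ →ₗ[ℝ] ℂ) := by
      refine (injective_iff_map_eq_zero _).2 fun v hv => ?_
      have hv' : A v = 0 := hv
      have := (h v).1
      rw [hv', norm_zero] at this
      exact norm_le_zero_iff.1 (nonpos_of_mul_nonpos_right this hl0)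
    have hsurj := LinearMap.injective_iff_surjective.1 hinj
    have hsub : ball (0 : ℂ) l ⊆ A '' ball 0 1 := by
      intro y hy
      obtain ⟨x, rfl⟩ := hsurj y
      refine ⟨x, ?_, rfl⟩
      have h3 := (h x).1
      have h4 : ‖A x‖ < l := mem_ball_zero_iff.1 hy
      rw [mem_ball_zero_iff]
      by_contra! hx
      nlinarith
    have hvol := measure_mono (μ := volume) hsub
    rw [Measure.addHaar_image_continuousLinearMap, Complex.volume_ball, Complex.volume_ball,
      ENNReal.ofReal_one, one_pow, one_mul,
      ENNReal.mul_le_mul_iff_left (by simpa using NNReal.pi_pos.ne') ENNReal.coe_ne_top,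
      ← ENNReal.ofReal_pow hl] at hvol
    exact (ENNReal.ofReal_le_ofReal_iff (abs_nonneg _)).1 hvol
  calc ‖A‖ ^ 2 ≤ (K * l) ^ 2 := by gcongr
    _ = K ^ 2 * l ^ 2 := by ring
    _ ≤ _ := by gcongr

end Distortion

/-! ### Energy bounds and weak derivatives -/

section Sobolev

variable {K ρ : ℝ} {f : ℂ → ℂ}

/-- The energy of an injective map of bounded distortion is controlled by the area of its image. -/
lemma lintegral_sq_fderiv_le (hK : 0 ≤ K) (hf : Function.Injective f)
    (hD : ∀ᵐ z, HasDistortionAt K f z) (hρ : ∀ z, ‖z‖ ≤ ρ → ‖f z‖ ≤ ρ) :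
    ∫⁻ z in closedBall 0 ρ, ‖fderiv ℝ f z‖ₑ ^ 2 ≤
      ENNReal.ofReal (K ^ 2) * volume (closedBall (0 : ℂ) ρ) := by
  set D := {z | DifferentiableAt ℝ f z}
  have hDm : MeasurableSet D := measurableSet_of_differentiableAt ℝ f
  have hDae : ∀ᵐ z, z ∈ D := by
    filter_upwards [hD] with z ⟨A, hA, _⟩ using hA.differentiableAt
  have hcongr : (closedBall (0 : ℂ) ρ : Set ℂ) =ᵐ[volume] (closedBall 0 ρ ∩ D : Set ℂ) := by
    filter_upwards [hDae] with z hz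
    exact propext ⟨fun h => ⟨h, hz⟩, fun h => h.1⟩
  rw [setLIntegral_congr hcongr]
  calc ∫⁻ z in closedBall 0 ρ ∩ D, ‖fderiv ℝ f z‖ₑ ^ 2
      ≤ ∫⁻ z in closedBall 0 ρ ∩ D,
          ENNReal.ofReal (K ^ 2) * ENNReal.ofReal |(fderiv ℝ f z).det| := by
        refine lintegral_mono_ae (ae_restrict_of_ae ?_)
        filter_upwards [hD] with z ⟨A, hA, hAK⟩
        rw [hA.fderiv, ← ofReal_norm, ← ENNReal.ofReal_pow (norm_nonneg _),
          ← ENNReal.ofReal_mul (sq_nonneg _)]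
        exact ENNReal.ofReal_le_ofReal (hAK.sq_norm_le hK)
    _ = ENNReal.ofReal (K ^ 2) * volume (f '' (closedBall 0 ρ ∩ D)) := by
        rw [lintegral_const_mul' _ _ ENNReal.ofReal_ne_top,
          lintegral_abs_det_fderiv_eq_addHaar_image volume (measurableSet_closedBall.inter hDm)
            (fun z hz => hz.2.hasFDerivAt.hasFDerivWithinAt) hf.injOn]
    _ ≤ _ := by
        gcongr
        rintro _ ⟨z, hz, rfl⟩
        simpa using hρ z (by simpa using hz.1)

lemma memLp_fderiv (hK : 0 ≤ K) (hf : Function.Injective f)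
    (hD : ∀ᵐ z, HasDistortionAt K f z) (hρ : ∀ z, ‖z‖ ≤ ρ → ‖f z‖ ≤ ρ) :
    MemLp (fderiv ℝ f) 2 (volume.restrict (closedBall 0 ρ)) := by
  refine ⟨(measurable_fderiv ℝ f).aestronglyMeasurable, ?_⟩
  rw [eLpNorm_lt_top_iff_lintegral_rpow_enorm_lt_top two_ne_zero ENNReal.ofNat_ne_top]
  have := lintegral_sq_fderiv_le hK hf hD hρ
  simp only [ENNReal.toReal_ofNat, ENNReal.rpow_ofNat]
  exact this.trans_lt (ENNReal.mul_lt_top ENNReal.ofReal_lt_top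
    (isCompact_closedBall _ _).measure_lt_top)

lemma lintegral_fderiv_le (hK : 0 ≤ K) (hf : Function.Injective f)
    (hD : ∀ᵐ z, HasDistortionAt K f z) (hρ : ∀ z, ‖z‖ ≤ ρ → ‖f z‖ ≤ ρ) {S : Set ℂ}
    (hS : S ⊆ closedBall 0 ρ) :
    ∫⁻ z in S, ‖fderiv ℝ f z‖ₑ ≤
      (ENNReal.ofReal (K ^ 2) * volume (closedBall (0 : ℂ) ρ)) ^ (1 / 2 : ℝ) *
        volume S ^ (1 / 2 : ℝ) := by
  have h := ENNReal.lintegral_mul_le_Lp_mul_Lq (volume.restrict S) Real.HolderConjugate.two_two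
    (f := fun z => ‖fderiv ℝ f z‖ₑ) (g := fun _ => 1)
    (measurable_fderiv ℝ f).enorm.aemeasurable aemeasurable_const
  simp only [Pi.mul_apply, mul_one, lintegral_const, Measure.restrict_apply_univ, ENNReal.rpow_ofNat,
    one_pow, one_mul] at h
  refine h.trans ?_
  gcongr
  exact (lintegral_mono_set hS).trans (lintegral_sq_fderiv_le hK hf hD hρ)

/-- The classical derivative of a Lipschitz map is its weak derivative. -/
lemma hasWeakDerivative_fderiv_of_lipschitz {C : ℝ≥0} (hf : LipschitzWith C f) :
    HasWeakDerivative f (fderiv ℝ f) := by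
  intro η hη hηc v
  obtain ⟨D, hD⟩ := hη.lipschitzWith_of_hasCompactSupport hηc (by simp)
  have hη1 : ContDiff ℝ 1 η := hη.of_le (by simp)
  have hdη : Continuous fun z => fderiv ℝ η z v :=
    (hη1.continuous_fderiv one_ne_zero).clm_apply continuous_const
  have hint1 : Integrable fun z => fderiv ℝ η z v • f z :=
    (hdη.smul hf.continuous).integrable_of_hasCompactSupport (hηc.fderiv_apply ℝ v).smul_right
  have hint2 : Integrable fun z => η z • fderiv ℝ f z v := by
    have h1 : Integrable fun z => ‖η z‖ * (C * ‖v‖) :=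
      (hη1.continuous.norm.integrable_of_hasCompactSupport hηc.norm).mul_const _
    refine h1.mono' (hη1.continuous.aestronglyMeasurable.smul
      (measurable_fderiv_apply_const ℝ f v).aestronglyMeasurable) (.of_forall fun z => ?_)
    rw [norm_smul]
    gcongr
    exact (fderiv ℝ f z).le_of_opNorm_le (norm_fderiv_le_of_lipschitz ℝ hf) v
  -- Integration by parts is applied to real-valued Lipschitz functions, so the identity is tested
  -- on real functionals.
  have key : ∀ L : ℂ →L[ℝ] ℝ, L (∫ z, fderiv ℝ η z v • f z) = L (-∫ z, η z • fderiv ℝ f z v) := by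
    intro L
    rw [map_neg, ← L.integral_comp_comm hint1, ← L.integral_comp_comm hint2]
    have h := (L.lipschitz.comp hf).integral_lineDeriv_mul_eq (μ := volume) hD hηc v
    have hae : ∀ᵐ z, lineDeriv ℝ (L ∘ f) z v * η z = L (η z • fderiv ℝ f z v) := by
      filter_upwards [hf.ae_differentiableAt (μ := volume)] with z hz
      have h1 : HasFDerivAt (L ∘ f) (L.comp (fderiv ℝ f z)) z :=
        L.hasFDerivAt.comp z hz.hasFDerivAt
      rw [h1.hasLineDerivAt v |>.lineDeriv, map_smul, smul_eq_mul, mul_comm]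
      rfl
    rw [integral_congr_ae hae] at h
    rw [h, ← integral_neg]
    refine integral_congr_ae (.of_forall fun z => ?_)
    have h2 := (hη1.differentiable one_ne_zero z).lineDeriv_eq_fderiv (v := -v)
    simp only [h2, map_neg, map_smul, smul_eq_mul, Function.comp_apply, neg_mul, neg_neg]
  exact Complex.ext (key Complex.reCLM) (key Complex.imCLM)

/-- A uniform limit of injective Lipschitz maps of bounded distortion is a Sobolev map if it agrees
with the approximations outside compact sets of small area. -/
theorem isSobolevLocWith_of_limit {f : ℕ → ℂ → ℂ} {F : ℂ → ℂ} {S : ℕ → Set ℂ} (hK : 0 ≤ K)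
    (hf : ∀ m, IsDiscMap (f m)) (hfi : ∀ m, Function.Injective (f m))
    (hfD : ∀ m, ∀ᵐ z, HasDistortionAt K (f m) z) (hFc : Continuous F)
    (hFi : Function.Injective F) (hFD : ∀ᵐ z, HasDistortionAt K F z)
    (hfF : TendstoUniformly f F atTop) (hS : ∀ m, IsCompact (S m))
    (hS0 : Tendsto (fun m => volume (S m)) atTop (𝓝 0))
    (hfS : ∀ m, ∀ z ∉ S m, F z = f m z) : IsSobolevLocWith F (fderiv ℝ F) := by
  have hfρ : ∀ ρ, 1 ≤ ρ → ∀ m z, ‖z‖ ≤ ρ → ‖f m z‖ ≤ ρ := fun ρ hρ m z hz => by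
    rcases le_total ‖z‖ 1 with h | h
    · exact ((hf m).norm_le z h).trans hρ
    · rwa [(hf m).eq_self z h]
  have hFρ : ∀ ρ, 1 ≤ ρ → ∀ z, ‖z‖ ≤ ρ → ‖F z‖ ≤ ρ := fun ρ hρ z hz =>
    le_of_tendsto (hfF.tendsto_at z).norm (.of_forall fun m => hfρ ρ hρ m z hz)
  have hball : ∀ C : Set ℂ, IsCompact C → ∃ ρ : ℝ, 1 ≤ ρ ∧ C ⊆ closedBall 0 ρ := fun C hC => by
    obtain ⟨r, hr⟩ := hC.isBounded.subset_closedBall 0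
    exact ⟨max 1 r, le_max_left _ _, hr.trans (closedBall_subset_closedBall (le_max_right _ _))⟩
  refine ⟨fun C hC => ?_, fun C hC => ?_, fun η hη hηc v => ?_⟩
  · obtain ⟨B, hB⟩ := hC.exists_bound_of_continuousOn hFc.continuousOn
    have : IsFiniteMeasure (volume.restrict C) := ⟨by simpa using hC.measure_lt_top⟩
    exact MemLp.of_bound hFc.aestronglyMeasurable B
      ((ae_restrict_iff' hC.measurableSet).2 (.of_forall hB))
  · obtain ⟨ρ, hρ, hCρ⟩ := hball C hC
    exact (memLp_fderiv hK hFi hFD (hFρ ρ hρ)).mono_measure (Measure.restrict_mono hCρ le_rfl)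
  obtain ⟨ρ, hρ, hηρ⟩ := hball _ hηc
  obtain ⟨M, hM⟩ := hηc.exists_bound_of_continuous hη.continuous
  have hη1 : ContDiff ℝ 1 η := hη.of_le (by simp)
  have hη0 : ∀ z ∉ closedBall 0 ρ, η z = 0 := fun z hz => image_eq_zero_of_notMem_tsupport
    fun h => hz (hηρ h)
  have hdη : Continuous fun z => fderiv ℝ η z v :=
    (hη1.continuous_fderiv one_ne_zero).clm_apply continuous_const
  have hdηc : HasCompactSupport fun z => fderiv ℝ η z v := hηc.fderiv_apply ℝ v
  have hweak : ∀ m, ∫ z, fderiv ℝ η z v • f m z = -∫ z, η z • fderiv ℝ (f m) z v := fun m => by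
    obtain ⟨C, -, hC⟩ := (hf m).lipschitz
    exact hasWeakDerivative_fderiv_of_lipschitz (LipschitzWith.of_dist_le' (K := C) fun z w => by
      simpa only [dist_eq_norm] using hC z w) η hη hηc v
  have hlim1 : Tendsto (fun m => ∫ z, fderiv ℝ η z v • f m z) atTop
      (𝓝 (∫ z, fderiv ℝ η z v • F z)) := by
    refine tendsto_integral_filter_of_dominated_convergence
      (fun z => ‖fderiv ℝ η z v‖ * (‖F z‖ + 1))
      (.of_forall fun m => (hdη.smul (hf m).continuous).aestronglyMeasurable) ?_ ?_
      (.of_forall fun z => (hfF.tendsto_at z).const_smul _)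
    · filter_upwards [Metric.tendstoUniformly_iff.1 hfF 1 one_pos] with m hm
      refine .of_forall fun z => ?_
      rw [norm_smul]
      gcongr
      have h1 := hm z
      rw [dist_eq_norm, norm_sub_rev] at h1
      linarith [norm_le_norm_add_norm_sub' (f m z) (F z)]
    · exact (hdη.norm.mul (hFc.norm.add continuous_const)).integrable_of_hasCompactSupport
        hdηc.norm.mul_right
  have hint : ∀ g : ℂ → ℂ, MemLp (fderiv ℝ g) 2 (volume.restrict (closedBall 0 ρ)) →
      Integrable fun z => η z • fderiv ℝ g z v := by
    intro g hg
    have : IsFiniteMeasure (volume.restrict (closedBall (0 : ℂ) ρ)) :=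
      ⟨by
        rw [Measure.restrict_apply_univ]
        exact (isCompact_closedBall (0 : ℂ) ρ).measure_lt_top⟩
    have h1 : Integrable (fun z => M * (‖fderiv ℝ g z‖ * ‖v‖))
        (volume.restrict (closedBall 0 ρ)) :=
      ((hg.integrable (by norm_num)).norm.mul_const _).const_mul _
    refine (integrableOn_iff_integrable_of_support_subset (s := closedBall 0 ρ) ?_).1
      (h1.mono' ?_ (.of_forall fun z => ?_))
    · intro z hz
      by_contra h
      exact hz (by simp [hη0 z h])
    · exact hη.continuous.aestronglyMeasurable.smul
        (measurable_fderiv_apply_const ℝ g v).aestronglyMeasurable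
    · rw [norm_smul]
      exact mul_le_mul (hM z) ((fderiv ℝ g z).le_opNorm v) (norm_nonneg _)
        ((norm_nonneg _).trans (hM z))
  set V := (ENNReal.ofReal (K ^ 2) * volume (closedBall (0 : ℂ) ρ)) ^ (1 / 2 : ℝ)
  have hV : V ≠ ⊤ := ENNReal.rpow_ne_top_of_nonneg (by norm_num)
    (ENNReal.mul_ne_top ENNReal.ofReal_ne_top (isCompact_closedBall _ _).measure_lt_top.ne)
  have hlim2 : Tendsto (fun m => ∫ z, η z • fderiv ℝ (f m) z v) atTop
      (𝓝 (∫ z, η z • fderiv ℝ F z v)) := by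
    refine tendsto_integral_of_L1 _ (hint F (memLp_fderiv hK hFi hFD (hFρ ρ hρ))).1
      (.of_forall fun m => hint _ (memLp_fderiv hK (hfi m) (hfD m) (hfρ ρ hρ m))) ?_
    -- The derivatives agree off `S m`; on it, Cauchy–Schwarz with the uniform energy bound gives
    -- the square root of its area, which tends to `0`.
    have hbound : ∀ m, ∫⁻ z, ‖η z • fderiv ℝ (f m) z v - η z • fderiv ℝ F z v‖ₑ ≤
        ENNReal.ofReal (M * ‖v‖) * (2 * (V * volume (S m) ^ (1 / 2 : ℝ))) := by
      intro m
      have hsupp : (Function.support fun z =>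
          ‖η z • fderiv ℝ (f m) z v - η z • fderiv ℝ F z v‖ₑ) ⊆ S m ∩ closedBall 0 ρ := by
        intro z hz
        by_contra h
        refine hz ?_
        by_cases hzρ : z ∈ closedBall 0 ρ
        · have hzS : z ∉ S m := fun hzS => h ⟨hzS, hzρ⟩
          have heq : F =ᶠ[𝓝 z] f m := by
            filter_upwards [(hS m).isClosed.isOpen_compl.mem_nhds hzS] with w hw using hfS m w hw
          simp [heq.fderiv_eq]
        · simp [hη0 z hzρ]
      rw [← setLIntegral_eq_of_support_subset hsupp]
      calc ∫⁻ z in S m ∩ closedBall 0 ρ, ‖η z • fderiv ℝ (f m) z v - η z • fderiv ℝ F z v‖ₑ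
          ≤ ∫⁻ z in S m ∩ closedBall 0 ρ, ENNReal.ofReal (M * ‖v‖) *
              (‖fderiv ℝ (f m) z‖ₑ + ‖fderiv ℝ F z‖ₑ) := by
            refine lintegral_mono fun z => ?_
            have h1 : ‖η z • fderiv ℝ (f m) z v - η z • fderiv ℝ F z v‖ ≤
                M * ‖v‖ * (‖fderiv ℝ (f m) z‖ + ‖fderiv ℝ F z‖) := by
              rw [← smul_sub, norm_smul, mul_assoc]
              refine mul_le_mul (hM z) ((norm_sub_le _ _).trans ?_) (norm_nonneg _)
                ((norm_nonneg _).trans (hM z))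
              rw [mul_comm, add_mul]
              exact add_le_add ((fderiv ℝ (f m) z).le_opNorm v) ((fderiv ℝ F z).le_opNorm v)
            have hM0 : 0 ≤ M := (norm_nonneg _).trans (hM z)
            simp only [← ofReal_norm]
            rw [← ENNReal.ofReal_add (norm_nonneg _) (norm_nonneg _),
              ← ENNReal.ofReal_mul (by positivity)]
            exact ENNReal.ofReal_le_ofReal h1
        _ = ENNReal.ofReal (M * ‖v‖) * ((∫⁻ z in S m ∩ closedBall 0 ρ, ‖fderiv ℝ (f m) z‖ₑ) +
              ∫⁻ z in S m ∩ closedBall 0 ρ, ‖fderiv ℝ F z‖ₑ) := by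
            rw [lintegral_const_mul' _ _ ENNReal.ofReal_ne_top,
              lintegral_add_left (measurable_fderiv ℝ (f m)).enorm]
        _ ≤ _ := by
            have hle : volume (S m ∩ closedBall 0 ρ) ^ (1 / 2 : ℝ) ≤
                volume (S m) ^ (1 / 2 : ℝ) :=
              ENNReal.rpow_le_rpow (measure_mono inter_subset_left) (by norm_num)
            rw [two_mul]
            gcongr
            · exact (lintegral_fderiv_le hK (hfi m) (hfD m) (hfρ ρ hρ m) inter_subset_right).trans
                (by gcongr)
            · exact (lintegral_fderiv_le hK hFi hFD (hFρ ρ hρ) inter_subset_right).trans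
                (by gcongr)
    have h0 : Tendsto (fun m => volume (S m) ^ (1 / 2 : ℝ)) atTop (𝓝 0) := by
      have h := ((ENNReal.continuous_rpow_const (y := 1 / 2)).tendsto 0).comp hS0
      rwa [ENNReal.zero_rpow_of_pos (by norm_num)] at h
    have h1 := ENNReal.Tendsto.const_mul (ENNReal.Tendsto.const_mul (ENNReal.Tendsto.const_mul
      (a := V) h0 (Or.inr hV)) (a := 2) (Or.inr ENNReal.ofNat_ne_top))
      (a := ENNReal.ofReal (M * ‖v‖)) (Or.inr ENNReal.ofReal_ne_top)
    simp only [mul_zero] at h1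
    exact tendsto_of_tendsto_of_tendsto_of_le_of_le tendsto_const_nhds h1 (fun _ => zero_le)
      hbound
  exact tendsto_nhds_unique hlim1 ((hlim2.neg).congr fun m => (hweak m).symm)

end Sobolev

/-! ### Choice of packings and conclusion -/

lemma rpow_le_half {α δ R : ℝ} (hα : 0 < α) (hR : 0 < R) (hδ : R ≤ δ)
    (h : δ ≤ (1 / 2) ^ α⁻¹) : R ^ α ≤ 1 / 2 :=
  calc R ^ α ≤ ((1 / 2 : ℝ) ^ α⁻¹) ^ α := Real.rpow_le_rpow hR.le (hδ.trans h) hα.le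
    _ = 1 / 2 := by rw [← Real.rpow_mul (by norm_num), inv_mul_cancel₀ hα.ne', Real.rpow_one]

/-- There are packings with arbitrarily small discs whose masses have products bounded below. -/
lemma exists_packings {α β : ℝ} (hα : 0 < α) (hβ : 0 < β) : ∃ P : ℕ → DiskPacking,
    (∀ n, (P n).Fine α) ∧ (∀ n, (P n).Fine β) ∧
    ∀ n, 1 / 2 ≤ ∏ k ∈ Finset.range n, (P k).mass := by
  set δ : ℝ := min ((1 / 2) ^ α⁻¹) ((1 / 2) ^ β⁻¹)
  have hδ : 0 < δ := lt_min (by positivity) (by positivity)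
  -- These target masses telescope: the product of the first `n` is `(n + 2) / (2 * (n + 1))`, which
  -- is at least `1 / 2`.
  have hη : ∀ n : ℕ, ((n : ℝ) + 3) * (n + 1) / (n + 2) ^ 2 < 1 := fun n => by
    rw [div_lt_one (by positivity)]
    nlinarith
  choose P hm hr using fun n : ℕ => DiskPacking.exists_mass_ge (hη n) hδ
  refine ⟨P, fun n i => rpow_le_half hα ((P n).radius_pos i) (hr n i) (min_le_left _ _),
    fun n i => rpow_le_half hβ ((P n).radius_pos i) (hr n i) (min_le_right _ _), fun n => ?_⟩
  have key : ((n : ℝ) + 2) / (2 * (n + 1)) ≤ ∏ k ∈ Finset.range n, (P k).mass := by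
    induction n with
    | zero => norm_num
    | succ n ih =>
      rw [Finset.prod_range_succ]
      refine le_trans (le_of_eq ?_) (mul_le_mul ih (hm n) (by positivity)
        (le_trans (by positivity) ih))
      push_cast
      field_simp
      ring
  refine le_trans ?_ key
  rw [div_le_div_iff₀ (by norm_num) (by positivity)]
  linarith

/-- The limit of the approximations is quasiconformal. -/
theorem exists_isQuasiconformal {K α : ℝ} (hK : 1 ≤ K) {P : ℕ → DiskPacking}
    (hP : ∀ n, (P n).Fine α) (hP' : ∀ n, (P n).Fine (α * K⁻¹)) :
    ∃ F : ℂ → ℂ, IsQuasiconformal K F ∧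
      F '' range (codePoint α P) = range (codePoint (α * K⁻¹) P) := by
  have hK0 : 0 < K := by linarith
  have hp : 0 < K⁻¹ := inv_pos.2 hK0
  obtain ⟨F, hF, hFh, hF1, hFS, hFE⟩ := exists_isHomeomorph_limit hP hp hP'
  have hvol : Tendsto (fun m => volume (cylinders α m P)) atTop (𝓝 0) := by
    have h1 : Tendsto (fun m : ℕ => ENNReal.ofReal ((1 / 4) ^ m) * volume (closedBall (0 : ℂ) 1))
        atTop (𝓝 0) := by
      have h2 := ENNReal.tendsto_ofReal (tendsto_pow_atTop_nhds_zero_of_lt_one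
        (r := (1 / 4 : ℝ)) (by norm_num) (by norm_num))
      have h3 := ENNReal.Tendsto.mul_const h2 (b := volume (closedBall (0 : ℂ) 1))
        (Or.inr (isCompact_closedBall _ _).measure_lt_top.ne)
      simpa only [ENNReal.ofReal_zero, zero_mul] using h3
    exact tendsto_of_tendsto_of_tendsto_of_le_of_le tendsto_const_nhds h1 (fun _ => zero_le)
      fun m => volume_cylinders_le m P hP
  have hnull : volume (⋂ m, cylinders α m P) = 0 :=
    le_antisymm (ge_of_tendsto' hvol fun m => measure_mono (iInter_subset _ m)) zero_le
  -- Off the null intersection of the cylinders, `F` coincides near the point with some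
  -- approximation.
  have hD : ∀ᵐ z, HasDistortionAt K F z := by
    filter_upwards [ae_all_iff.2 fun m => ae_hasDistortionAt_approx hK m hP,
      compl_mem_ae_iff.2 hnull] with z hz hzS
    simp only [mem_compl_iff, mem_iInter, not_forall] at hzS
    obtain ⟨m, hm⟩ := hzS
    refine (hz m).congr ?_
    filter_upwards [(isCompact_cylinders m P).isClosed.isOpen_compl.mem_nhds hm] with w hw
    exact hFS m w hw
  refine ⟨F, ⟨hFh, isOrientationPreserving_of_eq_self hFh hF1, fderiv ℝ F, ?_, ?_⟩, hFE⟩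
  · exact isSobolevLocWith_of_limit hK0.le (fun m => isDiscMap_approx hP hp m)
      (fun m => Function.LeftInverse.injective (approx_inv_approx hP hp hP' m))
      (fun m => ae_hasDistortionAt_approx hK m hP) hFh.continuous hFh.injective hD
      (tendstoUniformly_of_norm_sub_le hF) (fun m => isCompact_cylinders m P) hvol hFS
  · filter_upwards [hD] with z ⟨A, hA, l, hl, hAl⟩ a b
    rw [hA.fderiv]
    have h1 := (hAl (Complex.exp (a * Complex.I))).2
    have h2 := (hAl (Complex.exp (b * Complex.I))).1
    rw [Complex.norm_exp_ofReal_mul_I, mul_one] at h1 h2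
    exact h1.trans (mul_le_mul_of_nonneg_left h2 hK0.le)

end DiskCantor

theorem theorem2p2 (K : ℝ) (hK : 1 < K) (t : ℝ) (ht0 : 0 < t) (ht2 : t < 2) :
    ∃ (E : Set ℂ) (φ : ℂ → ℂ),
      IsCompact E ∧
      0 < Measure.hausdorffMeasure t E ∧ Measure.hausdorffMeasure t E < ⊤ ∧
      IsQuasiconformal K φ ∧
      0 < Measure.hausdorffMeasure (2 * K * t / (2 + (K - 1) * t)) (φ '' E) ∧
      Measure.hausdorffMeasure (2 * K * t / (2 + (K - 1) * t)) (φ '' E) < ⊤ := by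
  have hK0 : 0 < K := by linarith
  have hden : 0 < 2 + (K - 1) * t := by nlinarith
  set α : ℝ := 2 / t - 1
  have hα : 0 < α := by
    rw [sub_pos, lt_div_iff₀ ht0]
    linarith
  have hαt : (1 + α) * t = 2 := by
    simp only [α]
    field_simp
    ring
  -- The formula for `t'` is exactly the exponent for which the image ratios `r ^ (1 + α / K)` again
  -- have powers `r ^ 2`.
  have hαt' : (1 + α * K⁻¹) * (2 * K * t / (2 + (K - 1) * t)) = 2 := by
    rw [mul_div_assoc', div_eq_iff hden.ne']
    simp only [α]
    field_simp
    ring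
  have ht0' : 0 < 2 * K * t / (2 + (K - 1) * t) := by positivity
  have ht2' : 2 * K * t / (2 + (K - 1) * t) < 2 := by
    rw [div_lt_iff₀ hden]
    nlinarith
  obtain ⟨P, hP, hP', hm⟩ := DiskCantor.exists_packings hα (β := α * K⁻¹) (by positivity)
  obtain ⟨φ, hφ, hφE⟩ := DiskCantor.exists_isQuasiconformal hK.le hP hP'
  refine ⟨Set.range (DiskCantor.codePoint α P), φ,
    isCompact_range (DiskCantor.continuous_codePoint hP),
    DiskCantor.hausdorffMeasure_range_codePoint_pos hP ht0 ht2 hαt one_half_pos hm,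
    DiskCantor.hausdorffMeasure_range_codePoint_lt_top hP ht0 hαt, hφ, ?_, ?_⟩
  · rw [hφE]
    exact DiskCantor.hausdorffMeasure_range_codePoint_pos hP' ht0' ht2' hαt' one_half_pos hm
  · rw [hφE]
    exact DiskCantor.hausdorffMeasure_range_codePoint_lt_top hP' ht0' hαt'
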